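/- A \emph{binar} is a set with one binary operation. Let $\mathfrak A$ be a finite collection of finite nonempty binars. An instance $I$ of $\mathrm{CSP}(\mathfrak A)$ consists of variables $0,\dots,n-1$, a binar $\mathbf A_v\in\mathfrak A$ for each variable $v$, and a finite list of constraints $(\sigma,R)$, where $\sigma\colon\{0,\dots,m-1\}\to\{0,\dots,n-1\}$ is a scope function and $R$ is a subset of $\prod_{k<m}A_{\sigma(k)}$ that is closed under the coordinatewise operation and projects onto every factor (a subdirect product). A \emph{solution} of $I$ is an $f\in\prod_{v<n}A_v$ with $f\circ\sigma\in R$ for every constraint $(\sigma,R)$. For a set $\alpha$ of variables, a solution of the \emph{partial instance} $I_\alpha$ is an $f\in\prod_{v\in\alpha}A_v$ such that, for every constraint $(\sigma,R)$, there is $r\in R$ with $r(k)=f(\sigma(k))$ for all $k$ with $\sigma(k)\in\alpha$. $\mathrm{CSP}(\mathfrak A)$ is \emph{tractable} if there is a deterministic polynomial-time Turing machine which, for every instance of $\mathrm{CSP}(\mathfrak A)$ (written as the list of its algebras followed by its constraints, each given by its scope, with variable indices in binary, and the list of all tuples of its relation), decides whether the instance has a solution. Let $\mathbf S_2=\langle\{0,1\},\min\rangle$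 be the two-element semilattice, and let $\mathbf{Sq}_3$ and $\mathbf A$ be the binars on $\{0,1,2\}$ and $\{0,1,2,3\}$ with the tables $$\mathbf{Sq}_3:\ \begin{array}{c|ccc}\cdot&0&1&2\\\hline 0&0&2&1\\1&2&1&0\\2&1&0&2\end{array}\qquad\qquad \mathbf A:\ \begin{array}{c|cccc}\cdot&0&1&2&3\\\hline 0&0&0&3&2\\1&0&1&3&2\\2&3&3&2&1\\3&2&2&1&3\end{array}$$ Then: 1. $\mathrm{CSP}(\{\mathbf S_2,\mathbf{Sq}_3\})$ is tractable. 2. Let $I$ be an instance of $\mathrm{CSP}(\{\mathbf S_2,\mathbf{Sq}_3\})$ and let $\alpha$ be the set of its variables $v$ with $\mathbf A_v=\mathbf{Sq}_3$. Then $I$ has a solution if and only if the partial instance $I_\alpha$ has one; moreover, if $f$ is a solution of $I_\alpha$, then the assignment equal to $f$ on $\alpha$ and to $0$ on all other variables is a solution of $I$. 3. $\mathrm{CSP}(\mathsf S(\mathbf A))$ is tractable, where $\mathsf S(\mathbf A)$ is the collection of all nonempty subalgebras of $\mathbf A$. -/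

import Mathlib

/-! ### Constraint satisfaction problems over a collection of binars

A collection of binars (algebras with one binary operation) is a family `A : ι → Type` with an
operation `Mul (A i)` for each `i`. -/

section CSP

variable {ι : Type} (A : ι → Type) [∀ i, Mul (A i)]

/-- A constraint on the variables `0, …, n-1`, where variable `v` ranges over the algebra
`A (alg v)`: a scope function `scope` together with a constraint relation, given by the list of its
tuples without repetition, that is closed under the operation of `∏ k, A (alg (scope k))` and
projects onto every factor, i.e. is the universe of a subdirect product. -/
structure CSPConstraint {n : ℕ} (alg : Fin n → ι) where
  arity : ℕ
  scope : Fin arity → Fin n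
  tuples : List (∀ k : Fin arity, A (alg (scope k)))
  nodup : tuples.Nodup
  mul_mem : ∀ x ∈ tuples, ∀ y ∈ tuples, x * y ∈ tuples
  subdirect : ∀ (k : Fin arity) (a : A (alg (scope k))), ∃ x ∈ tuples, x k = a

/-- An instance of `CSP(A)`: finitely many variables `0, …, n-1`, an algebra of the collection for
each variable, and a finite list of constraints. -/
structure CSPInstance where
  n : ℕ
  alg : Fin n → ι
  constraints : List (CSPConstraint A alg)

namespace CSPConstraint

variable {A} {n : ℕ} {alg : Fin n → ι}

/-- The constraint relation, as a subalgebra of the product of the algebras in its scope. -/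
def rel (c : CSPConstraint A alg) : Subsemigroup (∀ k : Fin c.arity, A (alg (c.scope k))) where
  carrier := {x | x ∈ c.tuples}
  mul_mem' := fun {x y} hx hy => c.mul_mem x hx y hy

end CSPConstraint

namespace CSPInstance

variable {A}

/-- `f` is a solution: `f ∘ σ ∈ R` for every constraint `(σ, R)`. -/
def IsSolution (I : CSPInstance A) (f : ∀ v : Fin I.n, A (I.alg v)) : Prop :=
  ∀ c ∈ I.constraints, (fun k => f (c.scope k)) ∈ c.rel

/-- The answer to the decision problem. -/
def HasSolution (I : CSPInstance A) : Prop :=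
  ∃ f, I.IsSolution f

/-- `f` is a solution of the partial instance of `I` on the set `α` of variables: for every
constraint `(σ, R)`, the restriction of `f ∘ σ` to `σ⁻¹(α)` belongs to the projection of `R` onto
the coordinates in `σ⁻¹(α)`. -/
def IsPartialSolution (I : CSPInstance A) (α : Set (Fin I.n)) (f : ∀ v : α, A (I.alg v)) : Prop :=
  ∀ c ∈ I.constraints, ∃ r ∈ c.rel, ∀ (k : Fin c.arity) (h : c.scope k ∈ α),
    r k = f ⟨c.scope k, h⟩

end CSPInstance

/-- The alphabet in which instances are written: names of the algebras of the collection, names of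
their elements, binary digits, and three markers. It is finite if the collection is a finite
collection of finite algebras. -/
inductive CSPSymbol
  | alg (i : ι)
  | elt (i : ι) (a : A i)
  | bit (b : Bool)
  | var
  | tup
  | con

namespace CSPConstraint

variable {A} {n : ℕ} {alg : Fin n → ι}

/-- The word describing a constraint: the indices of the variables in its scope, in binary, and
then all tuples of its relation, entry by entry. -/
def encode (c : CSPConstraint A alg) : List (CSPSymbol A) :=
  CSPSymbol.con ::
    ((List.ofFn c.scope).flatMap fun v : Fin n =>
        CSPSymbol.var :: (Computability.encodeNat (v : ℕ)).map CSPSymbol.bit) ++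
    c.tuples.flatMap fun x =>
      CSPSymbol.tup :: List.ofFn fun k => CSPSymbol.elt (alg (c.scope k)) (x k)

end CSPConstraint

/-- The word describing an instance: the list of its algebras and then the list of its
constraints. -/
def CSPInstance.encode {A : ι → Type} [∀ i, Mul (A i)] (I : CSPInstance A) : List (CSPSymbol A) :=
  (List.ofFn fun v => CSPSymbol.alg (I.alg v)) ++ I.constraints.flatMap CSPConstraint.encode

open Classical in
/-- `CSP(A)` is tractable: there are a (multi-stack) Turing machine and a polynomial `p` such that
the machine, started on the word describing any instance of `CSP(A)`, halts within `p` of the length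
of this word many steps and outputs whether or not the instance has a solution. -/
def CSPTractable : Prop :=
  Nonempty (Turing.TM2ComputableInPolyTime (CSPInstance.encode (A := A)) Computability.encodeBool
    fun I : CSPInstance A => decide I.HasSolution)

end CSP

/-! ### The algebras -/

/-- The universe of the two-element semilattice. -/
def Slt : Type := Fin 2

instance : Mul Slt := ⟨fun x y : Fin 2 => (min x y : Fin 2)⟩

/-- The universe of the three-element Steiner quasigroup. -/
def Sq3 : Type := Fin 3

instance : Mul Sq3 := ⟨fun x y : Fin 3 =>
  (!![0, 2, 1;
      2, 1, 0;
      1, 0, 2] : Matrix (Fin 3) (Fin 3) (Fin 3)) x y⟩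

/-- The universe of the four-element commutative idempotent binar. -/
def Cib4 : Type := Fin 4

instance : Mul Cib4 := ⟨fun x y : Fin 4 =>
  (!![0, 0, 3, 2;
      0, 1, 3, 2;
      3, 3, 2, 1;
      2, 2, 1, 3] : Matrix (Fin 4) (Fin 4) (Fin 4)) x y⟩

/-- Names for the two members of the collection `{Slt, Sq3}`. -/
inductive SltSq3
  | slt
  | sq3
  deriving DecidableEq

namespace SltSq3

/-- The collection `{Slt, Sq3}`. -/
def Carrier : SltSq3 → Type
  | slt => Slt
  | sq3 => Sq3

instance : ∀ i : SltSq3, Mul (Carrier i)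
  | slt => inferInstanceAs (Mul Slt)
  | sq3 => inferInstanceAs (Mul Sq3)

/-- The element named `0`; in `Slt` it is the bottom element. -/
def zero : ∀ i : SltSq3, Carrier i
  | slt => (0 : Fin 2)
  | sq3 => (0 : Fin 3)

end SltSq3

/-- The collection of all (nonempty) subalgebras of a binar `M`, indexed by themselves. -/
def Subalgebras (M : Type) [Mul M] (B : {B : Subsemigroup M // (B : Set M).Nonempty}) : Type :=
  ↥B.1

instance (M : Type) [Mul M] (B : {B : Subsemigroup M // (B : Set M).Nonempty}) :
    Mul (Subalgebras M B) :=
  inferInstanceAs (Mul ↥B.1)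

/-! Every algebra involved has a homomorphism to the Steiner quasigroup on `ZMod 3`, where `x * y =
-(x + y)`: `Sq3` bijectively, `Slt` constantly, `Cib4` by collapsing `{0, 1}`, and its subalgebras
by restriction. In that quasigroup `x * ((x * y) * y) = x`, so in the original algebras this term
moves `x` only within its fibre. For a suitable `y` (the bottom, where there is one) it sends `x` to
a canonical element of the fibre, and canonical elements are fixed whatever `y` is. As constraints
are subdirect, at each coordinate the suitable `y` occurs in some tuple. Applying the term once per
coordinate shows that, with any tuple, a relation contains the tuple of canonical representatives
(`canon_mem_rel`). Hence an instance is solvable iff its image over `ZMod 3` is, and solutions of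
the image lift by canonical representatives (`isSolution_canon`). The statement on partial instances
is a special case.

Relations closed under `-(x + y)` are empty or affine subspaces (`exists_seq_eq_of_mem_tupleSpan`).
So an assignment is a solution iff on each scope it is a linear combination of tuples with
coefficient sum 1. This is a linear system with one column for the constants and one for each
variable and each tuple. It is solvable iff some combination of columns vanishes everywhere except
at a last coordinate that marks the column of constants (`IsColumns.separated_iff`). Eliminating one
coordinate at a time decides this (`mem_colSpan_elim`).

The remainder is an explicit stack machine. It writes the columns by sweeping over the input: each
round decrements all variable indices in place, so that in round `k` exactly the index `k`
underflows, and then cuts off the last tuple. The number of rounds is the length of the input, which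
bounds the numbers of variables and of tuples; surplus columns are zero and do no harm. The total
time is cubic. -/

namespace AffineCSP

/-! ### Gaussian elimination on lists of columns over `ZMod 3` -/

/-- A list, as a finitely supported sequence. -/
def seq (l : List (ZMod 3)) : ℕ → ZMod 3 := fun i => l.getD i 0

@[simp] lemma seq_nil : seq [] = 0 := by
  funext i; simp [seq]

@[simp] lemma seq_cons_zero (x : ZMod 3) (l : List (ZMod 3)) : seq (x :: l) 0 = x := rfl

@[simp] lemma seq_cons_succ (x : ZMod 3) (l : List (ZMod 3)) (i : ℕ) :
    seq (x :: l) (i + 1) = seq l i := by simp [seq]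

/-- Prepend `n` zeros to a sequence. -/
def shift (n : ℕ) : (ℕ → ZMod 3) →ₗ[ZMod 3] (ℕ → ZMod 3) where
  toFun f i := if i < n then 0 else f (i - n)
  map_add' f g := by
    funext i
    by_cases h : i < n <;> simp [h]
  map_smul' a f := by
    funext i
    by_cases h : i < n <;> simp [h]

lemma shift_apply (n : ℕ) (f : ℕ → ZMod 3) (i : ℕ) :
    shift n f i = if i < n then 0 else f (i - n) := rfl

@[simp] lemma shift_add_apply (n : ℕ) (f : ℕ → ZMod 3) (i : ℕ) : shift n f (i + n) = f i := by
  simp [shift_apply]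

lemma shift_shift (m n : ℕ) (f : ℕ → ZMod 3) : shift m (shift n f) = shift (m + n) f := by
  funext i
  simp only [shift_apply]
  by_cases h : i < m
  · simp [h, show i < m + n by omega]
  · by_cases h' : i < m + n
    · simp [h, h', show i - m < n by omega]
    · simp [h, h', show ¬ (i - m < n) by omega, Nat.sub_sub]

lemma seq_append (l r : List (ZMod 3)) : seq (l ++ r) = seq l + shift l.length (seq r) := by
  funext i
  simp only [seq, Pi.add_apply, shift_apply]
  by_cases h : i < l.length
  · simp [h, List.getElem?_append]
  · simp [h, List.getElem?_append]

@[simp] lemma seq_replicate_zero (n : ℕ) : seq (List.replicate n 0) = 0 := by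
  funext i
  simp only [seq, List.getD_eq_getElem?_getD, List.getElem?_replicate]
  split_ifs <;> simp

/-- The linear span of a list of columns. -/
def colSpan (vs : List (List (ZMod 3))) : Submodule (ZMod 3) (ℕ → ZMod 3) :=
  Submodule.span (ZMod 3) (seq '' {v | v ∈ vs})

lemma seq_mem_colSpan {vs : List (List (ZMod 3))} {v : List (ZMod 3)} (h : v ∈ vs) :
    seq v ∈ colSpan vs := Submodule.subset_span ⟨v, h, rfl⟩

lemma mem_colSpan_cons {v : List (ZMod 3)} {vs : List (List (ZMod 3))} {f : ℕ → ZMod 3} :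
    f ∈ colSpan (v :: vs) ↔ ∃ a : ZMod 3, ∃ z ∈ colSpan vs, f = a • seq v + z := by
  have : seq '' {w | w ∈ v :: vs} = insert (seq v) (seq '' {w | w ∈ vs}) := by
    ext g
    simp [eq_comm]
  rw [colSpan, this, Submodule.mem_span_insert]
  rfl

@[simp] lemma mem_colSpan_nil {f : ℕ → ZMod 3} : f ∈ colSpan [] ↔ f = 0 := by
  simp [colSpan]

/-- Subtract `c` times the column `p`, if there is one, from a column. -/
def reduce (c : ZMod 3) : List (ZMod 3) → List (ZMod 3) → List (ZMod 3)
  | [], _ => []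
  | x :: v, [] => x :: reduce c v []
  | x :: v, y :: p => (x - c * y) :: reduce c v p

@[simp] lemma reduce_nil (c : ZMod 3) (v : List (ZMod 3)) : reduce c v [] = v := by
  induction v with
  | nil => rfl
  | cons x v ih => simp [reduce, ih]

@[simp] lemma length_reduce (c : ZMod 3) (v p : List (ZMod 3)) :
    (reduce c v p).length = v.length := by
  induction v generalizing p with
  | nil => rfl
  | cons x v ih => cases p <;> simp [reduce, ih]

/-- The bound on `p` matters because `reduce` keeps the length of `v` and would cut off a longer
pivot. -/
lemma seq_reduce (c : ZMod 3) {v p : List (ZMod 3)} (h : p.length ≤ v.length) :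
    seq (reduce c v p) = seq v - c • seq p := by
  induction v generalizing p with
  | nil =>
    obtain rfl : p = [] := by simpa using h
    simp [reduce]
  | cons x v ih =>
    cases p with
    | nil => simp
    | cons y p =>
      funext i
      have := ih (p := p) (by simpa using h)
      cases i with
      | zero => simp [reduce]
      | succ i => simp [reduce, this]

/-- Eliminate the first coordinate from a list of columns. The pivot column found so far has head
`a` and tail `p`; there is none if `a = 0`. -/
def elim : ZMod 3 → List (ZMod 3) → List (List (ZMod 3)) → List (List (ZMod 3))
  | _, _, [] => []
  | a, p, [] :: vs => elim a p vs
  | a, p, (x :: v) :: vs =>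
      if a = 0 ∧ x ≠ 0 then elim x v vs else reduce (x * a⁻¹) v p :: elim a p vs

lemma shift_one_tail {f : ℕ → ZMod 3} (h : f 0 = 0) : shift 1 (fun i => f (i + 1)) = f := by
  funext i
  cases i with
  | zero => simp [shift_apply, h]
  | succ i => simp

lemma shift_one_injective : Function.Injective (shift 1) := by
  intro f g h
  funext i
  simpa using congrFun h (i + 1)

/-- The reduced columns have first coordinate 0 and, together with the pivot, span the same space.
As the pivot has nonzero head, a combination with first coordinate 0 cannot use it, so it may be
dropped. -/
lemma mem_colSpan_elim_of_pivot {m : ℕ} {a : ZMod 3} (ha : a ≠ 0) {p : List (ZMod 3)}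
    (hp : p.length = m) {vs : List (List (ZMod 3))} (hvs : ∀ v ∈ vs, v.length = m + 1)
    (g : ℕ → ZMod 3) :
    g ∈ colSpan (elim a p vs) ↔ shift 1 g ∈ colSpan ((a :: p) :: vs) := by
  induction vs generalizing g with
  | nil =>
    simp only [elim, mem_colSpan_nil, mem_colSpan_cons, exists_eq_left, add_zero]
    constructor
    · rintro rfl
      exact ⟨0, by simp⟩
    · rintro ⟨b, hb⟩
      have h0 := congrFun hb 0
      have : b = 0 := by simpa [shift_apply, ha, eq_comm] using h0
      apply shift_one_injective
      simp [hb, this]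
  | cons v vs ih =>
    obtain _ | ⟨x, v⟩ := v
    · simpa using hvs [] (by simp)
    have hv : v.length = m := by simpa using hvs (x :: v) (by simp)
    have hred : shift 1 (seq (reduce (x * a⁻¹) v p)) = seq (x :: v) - (x * a⁻¹) • seq (a :: p) := by
      funext i
      cases i with
      | zero => simp [shift_apply, ha]
      | succ i => simp [seq_reduce _ (hp.trans hv.symm).le]
    have ih' := fun g => ih (fun w hw => hvs w (by simp [hw])) g
    rw [elim, if_neg (by simp [ha])]
    simp only [mem_colSpan_cons] at ih' ⊢
    constructor
    · rintro ⟨b, z, hz, rfl⟩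
      obtain ⟨d, y, hy, hzy⟩ := (ih' z).1 hz
      -- The multiple of the pivot subtracted in the reduction is charged to the coefficient of the
      -- pivot.
      refine ⟨d - b * (x * a⁻¹), b • seq (x :: v) + y, ⟨b, y, hy, rfl⟩, ?_⟩
      rw [map_add, map_smul, hred, hzy]
      module
    · rintro ⟨d, _, ⟨b, y, hy, rfl⟩, hg⟩
      refine ⟨b, g - b • seq (reduce (x * a⁻¹) v p), (ih' _).2 ⟨d + b * (x * a⁻¹), y, hy, ?_⟩, by simp⟩
      rw [map_sub, map_smul, hred, hg]
      module

/-- Elimination computes the kernel of the first coordinate on the span, and then drops that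
coordinate. Columns before the pivot have head 0 and only lose it. -/
lemma mem_colSpan_elim {m : ℕ} {vs : List (List (ZMod 3))} (hvs : ∀ v ∈ vs, v.length = m + 1)
    (g : ℕ → ZMod 3) : g ∈ colSpan (elim 0 [] vs) ↔ shift 1 g ∈ colSpan vs := by
  induction vs generalizing g with
  | nil =>
    simp only [elim, mem_colSpan_nil]
    exact (map_eq_zero_iff (shift 1) shift_one_injective).symm
  | cons v vs ih =>
    obtain _ | ⟨x, v⟩ := v
    · simpa using hvs [] (by simp)
    have hv : v.length = m := by simpa using hvs (x :: v) (by simp)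
    have hvs' : ∀ w ∈ vs, w.length = m + 1 := fun w hw => hvs w (by simp [hw])
    rw [elim]
    by_cases hx : x = 0
    · subst hx
      have hs : shift 1 (seq v) = seq (0 :: v) := by
        funext i
        cases i <;> simp [shift_apply]
      simp only [ne_eq, not_true_eq_false, and_false, if_false, reduce_nil, mem_colSpan_cons]
      constructor
      · rintro ⟨b, z, hz, rfl⟩
        exact ⟨b, shift 1 z, (ih hvs' z).1 hz, by rw [map_add, map_smul, hs]⟩
      · rintro ⟨b, z, hz, hg⟩
        refine ⟨b, g - b • seq v, (ih hvs' _).2 ?_, by simp⟩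
        rw [map_sub, map_smul, hs, hg]
        simpa using hz
    · rw [if_pos ⟨rfl, hx⟩]
      exact mem_colSpan_elim_of_pivot hx hv hvs' g

lemma length_of_mem_elim {m : ℕ} {a : ZMod 3} {p : List (ZMod 3)} {vs : List (List (ZMod 3))}
    (hvs : ∀ v ∈ vs, v.length = m + 1) : ∀ w ∈ elim a p vs, w.length = m := by
  induction vs generalizing a p with
  | nil => simp [elim]
  | cons v vs ih =>
    have hvs' : ∀ w ∈ vs, w.length = m + 1 := fun w hw => hvs w (by simp [hw])
    obtain _ | ⟨x, v⟩ := v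
    · simpa using hvs [] (by simp)
    have hv : v.length = m := by simpa using hvs (x :: v) (by simp)
    rw [elim]
    split_ifs with h
    · exact ih hvs'
    · intro w hw
      obtain rfl | hw := List.mem_cons.1 hw
      · simpa using hv
      · exact ih hvs' w hw

lemma length_elim_le (a : ZMod 3) (p : List (ZMod 3)) (vs : List (List (ZMod 3))) :
    (elim a p vs).length ≤ vs.length := by
  induction vs generalizing a p with
  | nil => simp [elim]
  | cons v vs ih =>
    obtain _ | ⟨x, v⟩ := v
    · rw [elim]
      exact (ih a p).trans (by simp)
    rw [elim]
    split_ifs with h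
    · exact (ih x v).trans (by simp)
    · simpa using ih a p

/-- Some linear combination of the columns vanishes in the first `m` coordinates, but not in the
following one. -/
def Separated (vs : List (List (ZMod 3))) (m : ℕ) : Prop :=
  ∃ f ∈ colSpan vs, (∀ i < m, f i = 0) ∧ f m ≠ 0

lemma separated_succ {m : ℕ} {vs : List (List (ZMod 3))} (hvs : ∀ v ∈ vs, v.length = m + 2) :
    Separated vs (m + 1) ↔ Separated (elim 0 [] vs) m := by
  constructor
  · rintro ⟨f, hf, h0, h1⟩
    refine ⟨fun i => f (i + 1), ?_, fun i hi => h0 _ (by omega), h1⟩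
    rw [mem_colSpan_elim hvs, shift_one_tail (h0 0 (by omega))]
    exact hf
  · rintro ⟨g, hg, h0, h1⟩
    refine ⟨shift 1 g, (mem_colSpan_elim hvs g).1 hg, fun i hi => ?_, by simpa using h1⟩
    cases i with
    | zero => simp [shift_apply]
    | succ i => simpa using h0 i (by omega)

/-- A linear functional vanishes on a span iff it vanishes on the generators. -/
lemma separated_zero {vs : List (List (ZMod 3))} :
    Separated vs 0 ↔ ∃ v ∈ vs, seq v 0 ≠ 0 := by
  constructor
  · rintro ⟨f, hf, -, h⟩
    by_contra! hv
    have : colSpan vs ≤ LinearMap.ker (LinearMap.proj 0 : (ℕ → ZMod 3) →ₗ[ZMod 3] ZMod 3) := by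
      rw [colSpan, Submodule.span_le]
      rintro _ ⟨v, hv', rfl⟩
      exact hv v hv'
    exact h (this hf)
  · rintro ⟨v, hv, h⟩
    exact ⟨seq v, seq_mem_colSpan hv, by simp, h⟩

end AffineCSP

namespace AffineCSP

/-! ### Systems of affine constraints -/

lemma seq_append_add (l r : List (ZMod 3)) (i : ℕ) : seq (l ++ r) (i + l.length) = seq r i := by
  simp [seq, List.getElem?_append]

lemma seq_append_lt {l : List (ZMod 3)} (r : List (ZMod 3)) {i : ℕ} (h : i < l.length) :
    seq (l ++ r) i = seq l i := by
  simp [seq, List.getElem?_append, h]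

lemma seq_injective_of_length {l r : List (ZMod 3)} (hl : l.length = r.length)
    (h : ∀ i < l.length, seq l i = seq r i) : l = r := by
  refine List.ext_getElem hl fun i h₁ h₂ => ?_
  simpa [seq, h₁, h₂] using h i h₁

/-- The variables in the scope of a constraint, and its tuples. -/
abbrev Block := List ℕ × List (List (ZMod 3))

/-- The number of equations that a list of constraints gives: one for each constraint, and one for
each entry of its scope. -/
def width : List Block → ℕ
  | [] => 0
  | b :: S => b.1.length + 1 + width S

/-- The column that has entry `e` at the constraints and `h v` at each occurrence of the
variable `v`. -/
def scopeCol (e : ZMod 3) (h : ℕ → ZMod 3) : List Block → List (ZMod 3)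
  | [] => []
  | b :: S => e :: b.1.map h ++ scopeCol e h S

/-- The columns given by the tuples of the constraints. -/
inductive TupleCol : List Block → List (ZMod 3) → Prop
  | here {vs : List ℕ} {ts : List (List (ZMod 3))} {S : List Block} {t : List (ZMod 3)} :
      t ∈ ts → TupleCol ((vs, ts) :: S) (1 :: t ++ scopeCol 0 0 S)
  | there {b : Block} {S : List Block} {c : List (ZMod 3)} :
      TupleCol S c → TupleCol (b :: S) (0 :: b.1.map 0 ++ c)

@[simp] lemma length_scopeCol (e : ZMod 3) (h : ℕ → ZMod 3) (S : List Block) :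
    (scopeCol e h S).length = width S := by
  induction S with
  | nil => rfl
  | cons b S ih => simp [scopeCol, width, ih]; omega

lemma scopeCol_zero (S : List Block) : scopeCol 0 0 S = List.replicate (width S) 0 := by
  refine List.eq_replicate_iff.2 ⟨by simp, ?_⟩
  induction S with
  | nil => simp [scopeCol]
  | cons b S ih =>
    simp only [scopeCol, List.cons_append, List.mem_cons, List.mem_append, List.mem_map]
    rintro x (rfl | ⟨a, -, rfl⟩ | h)
    exacts [rfl, rfl, ih x h]

/-- The tuples of a constraint have the length of its scope and form an affine subspace. -/
structure Block.IsAffine (b : Block) : Prop where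
  length_eq : ∀ t ∈ b.2, t.length = b.1.length
  closed : ∀ s ∈ b.2, ∀ t ∈ b.2, ∃ u ∈ b.2, seq u = -(seq s + seq t)

lemma TupleCol.length_eq {S : List Block} {c : List (ZMod 3)} (hc : TupleCol S c)
    (hS : ∀ b ∈ S, b.IsAffine) : c.length = width S := by
  induction hc with
  | here ht => simp [width, (hS _ (List.mem_cons_self)).length_eq _ ht]; omega
  | there _ ih =>
    simp [width, ih fun b hb => hS b (List.mem_cons_of_mem _ hb)]; omega

/-- The span of the tuples of a constraint, extended by an entry `1`. -/
def tupleSpan (ts : List (List (ZMod 3))) : Submodule (ZMod 3) (ZMod 3 × (ℕ → ZMod 3)) :=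
  Submodule.span (ZMod 3) ((fun t => ((1 : ZMod 3), seq t)) '' {t | t ∈ ts})

/-- Since `-(t₀ + -(s + t)) = s + t - t₀`, the translate of the tuples by `-t₀` is closed under
addition. Over `ZMod 3` every scalar multiple is a repeated sum, so it is a subspace. The invariant
carried through the span is that `p.2 - p.1 • seq t₀ + seq t₀` is a tuple; at `p.1 = 1` this is
`p.2`. -/
lemma exists_seq_eq_of_mem_tupleSpan {ts : List (List (ZMod 3))}
    (hts : ∀ s ∈ ts, ∀ t ∈ ts, ∃ u ∈ ts, seq u = -(seq s + seq t)) {f : ℕ → ZMod 3}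
    (hf : ((1 : ZMod 3), f) ∈ tupleSpan ts) : ∃ t ∈ ts, seq t = f := by
  obtain rfl | hne := eq_or_ne ts []
  · simp [tupleSpan] at hf
  obtain ⟨t₀, ht₀⟩ := List.exists_mem_of_ne_nil ts hne
  have hadd : ∀ p q : ZMod 3 × (ℕ → ZMod 3), (∃ t ∈ ts, seq t = p.2 - p.1 • seq t₀ + seq t₀) →
      (∃ t ∈ ts, seq t = q.2 - q.1 • seq t₀ + seq t₀) →
      ∃ t ∈ ts, seq t = (p + q).2 - (p + q).1 • seq t₀ + seq t₀ := by
    rintro p q ⟨s, hs, hs'⟩ ⟨t, ht, ht'⟩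
    obtain ⟨u, hu, hu'⟩ := hts s hs t ht
    obtain ⟨w, hw, hw'⟩ := hts t₀ ht₀ u hu
    refine ⟨w, hw, ?_⟩
    rw [hw', hu', hs', ht', Prod.snd_add, Prod.fst_add]
    module
  have key : ∀ p ∈ tupleSpan ts, ∃ t ∈ ts, seq t = p.2 - p.1 • seq t₀ + seq t₀ := by
    intro p hp
    induction hp using Submodule.span_induction with
    | mem p hp =>
      obtain ⟨t, ht, rfl⟩ := hp
      exact ⟨t, ht, by simp⟩
    | zero => exact ⟨t₀, ht₀, by simp⟩
    | add p q _ _ hp hq => exact hadd p q hp hq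
    | smul a p _ hp =>
      have h0 : ∃ t ∈ ts, seq t = ((0 : ZMod 3) • p).2 - ((0 : ZMod 3) • p).1 • seq t₀ + seq t₀ :=
        ⟨t₀, ht₀, by simp⟩
      have h2 : (2 : ZMod 3) • p = p + p := two_smul _ p
      obtain rfl | rfl | rfl : a = 0 ∨ a = 1 ∨ a = 2 := by revert a; decide
      · exact h0
      · simpa using hp
      · rw [h2]
        exact hadd p p hp hp
  simpa using key _ hf

/-- The sequence `f` is `m` times the column of the constants, plus a combination of columns of
variables with coefficients `y`, plus a combination of columns of tuples. -/
def Rep (m : ZMod 3) (y : ℕ → ZMod 3) : List Block → (ℕ → ZMod 3) → Prop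
  | [], f => f 0 = m
  | b :: S, f =>
      (∃ q ∈ tupleSpan b.2, f 0 = m + q.1 ∧
        ∀ (i : ℕ) (h : i < b.1.length), f (i + 1) = y b.1[i] + q.2 i) ∧
      Rep m y S fun i => f (i + (b.1.length + 1))

lemma Rep.zero (S : List Block) : Rep 0 0 S 0 := by
  induction S with
  | nil => simp [Rep]
  | cons b S ih => exact ⟨⟨0, zero_mem _, by simp, by simp⟩, ih⟩

lemma Rep.add {m n : ZMod 3} {y z f g : ℕ → ZMod 3} {S : List Block} (hf : Rep m y S f)
    (hg : Rep n z S g) : Rep (m + n) (y + z) S (f + g) := by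
  induction S generalizing f g with
  | nil => simp_all [Rep]
  | cons b S ih =>
    obtain ⟨⟨p, hp, hp0, hp1⟩, hf⟩ := hf
    obtain ⟨⟨q, hq, hq0, hq1⟩, hg⟩ := hg
    refine ⟨⟨p + q, add_mem hp hq, ?_, fun i h => ?_⟩, ih hf hg⟩
    · simp only [Pi.add_apply, hp0, hq0, Prod.fst_add]
      ring
    · simp only [Pi.add_apply, hp1 i h, hq1 i h, Prod.snd_add]
      ring

lemma Rep.smul {m : ZMod 3} {y f : ℕ → ZMod 3} {S : List Block} (a : ZMod 3) (hf : Rep m y S f) :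
    Rep (a * m) (a • y) S (a • f) := by
  induction S generalizing f with
  | nil => simp_all [Rep]
  | cons b S ih =>
    obtain ⟨⟨p, hp, hp0, hp1⟩, hf⟩ := hf
    refine ⟨⟨a • p, Submodule.smul_mem _ a hp, ?_, fun i h => ?_⟩, ih hf⟩
    · simp [hp0, mul_add]
    · simp [hp1 i h, mul_add]

lemma Rep.cons {m : ZMod 3} {y : ℕ → ZMod 3} {b : Block} {S : List Block} {x : ZMod 3}
    {l r : List (ZMod 3)} {q : ZMod 3 × (ℕ → ZMod 3)} (hl : l.length = b.1.length)
    (hq : q ∈ tupleSpan b.2) (h0 : x = m + q.1)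
    (h1 : ∀ (i : ℕ) (h : i < b.1.length), seq l i = y b.1[i] + q.2 i) (hr : Rep m y S (seq r)) :
    Rep m y (b :: S) (seq (x :: l ++ r)) := by
  refine ⟨⟨q, hq, by simpa using h0, fun i h => ?_⟩, ?_⟩
  · rw [List.cons_append, seq_cons_succ, seq_append_lt _ (by omega), h1 i h]
  · convert! hr using 2 with i
    rw [← hl]
    exact seq_append_add (x :: l) r i

lemma rep_scopeCol (m : ZMod 3) (y : ℕ → ZMod 3) (S : List Block) :
    Rep m y S (seq (scopeCol m y S ++ [m])) := by
  induction S with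
  | nil => simp [Rep, scopeCol]
  | cons b S ih =>
    rw [scopeCol, List.append_assoc]
    refine Rep.cons (by simp) (zero_mem _) (by simp) (fun i h => ?_) ih
    simp [seq, h]

lemma TupleCol.rep {S : List Block} {c : List (ZMod 3)} (hc : TupleCol S c)
    (hS : ∀ b ∈ S, b.IsAffine) : Rep 0 0 S (seq (c ++ [0])) := by
  induction hc with
  | @here vs ts S t ht =>
    rw [List.append_assoc]
    exact Rep.cons ((hS _ (List.mem_cons_self)).length_eq _ ht)
      (Submodule.subset_span ⟨t, ht, rfl⟩) (by simp) (fun i h => by simp) (rep_scopeCol 0 0 S)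
  | @there b S c _ ih =>
    rw [List.append_assoc]
    refine Rep.cons (by simp) (zero_mem _) (by simp) (fun i h => ?_)
      (ih fun b hb => hS b (List.mem_cons_of_mem _ hb))
    simp [seq, h]

/-- The entry after all the constraints sees only the column of the constants, so a nonzero value
there makes it possible to divide by `m`. -/
lemma Rep.apply_width {m : ZMod 3} {y f : ℕ → ZMod 3} {S : List Block} (hf : Rep m y S f) :
    f (width S) = m := by
  induction S generalizing f with
  | nil => exact hf
  | cons b S ih =>
    have := ih hf.2
    rwa [← add_comm] at this

/-- Where `f` vanishes, the combination `q` of tuples of a constraint has coefficient sum `-m` and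
entries `-y` along the scope. Scaling by `-m⁻¹` makes it an affine combination equal to `m⁻¹ • y`,
which is a tuple because tuples form an affine subspace. -/
lemma Rep.exists_map_mem {m : ZMod 3} (hm : m ≠ 0) {y f : ℕ → ZMod 3} {S : List Block}
    (hf : Rep m y S f) (h0 : ∀ i < width S, f i = 0) (hS : ∀ b ∈ S, b.IsAffine) :
    ∀ b ∈ S, b.1.map (m⁻¹ • y) ∈ b.2 := by
  induction S generalizing f with
  | nil => simp
  | cons b S ih =>
    obtain ⟨⟨q, hq, hq0, hq1⟩, hf⟩ := hf
    intro b' hb'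
    obtain rfl | hb' := List.mem_cons.1 hb'
    · have hb := hS b' (by simp)
      rw [h0 0 (by simp [width])] at hq0
      have hq' : ((1 : ZMod 3), (-m⁻¹) • q.2) ∈ tupleSpan b'.2 := by
        convert Submodule.smul_mem _ (-m⁻¹) hq using 1
        ext1
        · rw [Prod.smul_fst, eq_neg_of_add_eq_zero_right hq0.symm]
          simp [hm]
        · rfl
      obtain ⟨t, ht, htq⟩ := exists_seq_eq_of_mem_tupleSpan hb.closed hq'
      convert ht
      refine seq_injective_of_length (by simp [hb.length_eq t ht]) fun i hi => ?_
      have hi : i < b'.1.length := by simpa using hi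
      have := hq1 i hi
      rw [h0 _ (by simp only [width]; omega)] at this
      rw [htq]
      simp [seq, hi, eq_neg_of_add_eq_zero_right this.symm]
    · exact ih hf (fun i hi => h0 _ (by simp only [width]; omega))
        (fun b hb => hS b (by simp [hb])) b' hb'

/-- The columns of a system: the column of the constants, the columns of the variables below `B`,
and the columns of the tuples. The last coordinate is `1` for the first of these only. -/
structure IsColumns (S : List Block) (B : ℕ) (cols : List (List (ZMod 3))) : Prop where
  sound : ∀ c ∈ cols, c = scopeCol 1 0 S ++ [1] ∨ (∃ h, c = scopeCol 0 h S ++ [0]) ∨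
    ∃ d, TupleCol S d ∧ c = d ++ [0]
  const_mem : scopeCol 1 0 S ++ [1] ∈ cols
  var_mem : ∀ v < B, scopeCol 0 (Pi.single v 1) S ++ [0] ∈ cols
  tuple_mem : ∀ d, TupleCol S d → d ++ [0] ∈ cols

lemma seq_scopeCol_congr {e : ZMod 3} {g h : ℕ → ZMod 3} {S : List Block} (l : List (ZMod 3))
    (H : ∀ b ∈ S, ∀ v ∈ b.1, g v = h v) :
    seq (scopeCol e g S ++ l) = seq (scopeCol e h S ++ l) := by
  congr 2
  induction S with
  | nil => rfl
  | cons b S ih =>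
    rw [scopeCol, scopeCol, ih fun b hb => H b (by simp [hb]),
      List.map_congr_left (H b (by simp))]

lemma seq_scopeCol_add (e e' : ZMod 3) (g h : ℕ → ZMod 3) (S : List Block) (x y : ZMod 3) :
    seq (scopeCol (e + e') (g + h) S ++ [x + y]) =
      seq (scopeCol e g S ++ [x]) + seq (scopeCol e' h S ++ [y]) := by
  induction S with
  | nil =>
    funext i
    cases i <;> simp [scopeCol]
  | cons b S ih =>
    simp only [scopeCol, List.append_assoc]
    rw [seq_append, seq_append _ (scopeCol e g S ++ _), seq_append _ (scopeCol e' h S ++ _), ih]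
    simp only [List.length_cons, List.length_map, map_add]
    have : seq ((e + e') :: b.1.map (g + h)) = seq (e :: b.1.map g) + seq (e' :: b.1.map h) := by
      funext i
      cases i with
      | zero => simp
      | succ i =>
        simp only [seq, List.getD_eq_getElem?_getD, List.getElem?_cons_succ, List.getElem?_map,
          Pi.add_apply]
        cases b.1[i]? <;> simp
    rw [this]
    abel

lemma seq_scopeCol_smul (a : ZMod 3) (h : ℕ → ZMod 3) (S : List Block) :
    seq (scopeCol 0 (a • h) S ++ [0]) = a • seq (scopeCol 0 h S ++ [0]) := by
  have h2 := seq_scopeCol_add 0 0 h h S 0 0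
  simp only [add_zero] at h2
  obtain rfl | rfl | rfl : a = 0 ∨ a = 1 ∨ a = 2 := by revert a; decide
  · rw [zero_smul, zero_smul, scopeCol_zero, seq_append]
    have : seq [0] = 0 := seq_replicate_zero 1
    simp [this]
  · simp
  · rw [two_smul, two_smul, h2]

lemma IsColumns.scopeCol_mem {S : List Block} {B : ℕ} {cols : List (List (ZMod 3))}
    (H : IsColumns S B cols) (hB : ∀ b ∈ S, ∀ v ∈ b.1, v < B) (g : ℕ → ZMod 3) :
    seq (scopeCol 0 g S ++ [0]) ∈ colSpan cols := by
  have key : ∀ C ≤ B, seq (scopeCol 0 (fun v => if v < C then g v else 0) S ++ [0]) ∈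
      colSpan cols := by
    intro C hC
    induction C with
    | zero =>
      have := seq_scopeCol_smul 0 g S
      rw [zero_smul, zero_smul] at this
      simp only [Nat.not_lt_zero, if_false]
      change seq (scopeCol 0 0 S ++ [0]) ∈ _
      rw [this]
      exact zero_mem _
    | succ C ih =>
      have hs : (fun v => if v < C + 1 then g v else 0) =
          (fun v => if v < C then g v else 0) + g C • Pi.single C 1 := by
        funext v
        obtain h | rfl | h := lt_trichotomy v C
        · simp [h, h.ne, h.trans (Nat.lt_succ_self C)]
        · simp
        · simp [h.not_gt, h.ne', show ¬ v < C + 1 by omega]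
      have := seq_scopeCol_add 0 0 (fun v => if v < C then g v else 0) (g C • Pi.single C 1) S 0 0
      simp only [add_zero] at this
      rw [hs, this, seq_scopeCol_smul]
      exact add_mem (ih (by omega)) (Submodule.smul_mem _ _ (seq_mem_colSpan (H.var_mem C hC)))
  rw [← seq_scopeCol_congr (g := fun v => if v < B then g v else 0) (h := g)]
  · exact key B le_rfl
  · intro b hb v hv
    simp [hB b hb v hv]

/-- The sequence is the sum, over all constraints, of the column of the tuple that `g` induces
there. The shift by `n` places the columns of the later constraints behind those already treated in
the induction. -/
lemma exists_shift_mem {S : List Block} {V : Submodule (ZMod 3) (ℕ → ZMod 3)} (n : ℕ)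
    (hV : ∀ d, TupleCol S d → shift n (seq (d ++ [0])) ∈ V) (g : ℕ → ZMod 3)
    (hg : ∀ b ∈ S, b.1.map g ∈ b.2) : shift n (seq (scopeCol 1 g S ++ [0])) ∈ V := by
  induction S generalizing n with
  | nil =>
    have : seq [0] = 0 := seq_replicate_zero 1
    simp [scopeCol, this]
  | cons b S ih =>
    have hz : seq (scopeCol 0 0 S ++ [0]) = 0 := by
      rw [scopeCol_zero]
      exact (congrArg seq List.replicate_succ'.symm).trans (seq_replicate_zero _)
    have hz' : seq (0 :: b.1.map 0) = 0 := by
      have : (0 : ZMod 3) :: b.1.map 0 = List.replicate (b.1.length + 1) 0 := by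
        rw [List.replicate_succ, List.cons_inj_right, List.eq_replicate_iff]
        simp
      rw [this, seq_replicate_zero]
    have h1 := hV _ (TupleCol.here (vs := b.1) (S := S) (hg b (by simp)))
    rw [List.append_assoc, seq_append, hz, map_zero, add_zero] at h1
    rw [scopeCol, List.append_assoc, seq_append, map_add]
    refine add_mem h1 ?_
    rw [shift_shift]
    refine ih _ (fun d hd => ?_) fun b hb => hg b (by simp [hb])
    have h2 := hV _ (TupleCol.there (b := b) hd)
    rw [List.append_assoc, seq_append, hz', zero_add, shift_shift] at h2
    simpa using h2

/-- A separating combination has a nonzero coefficient `m` at the constants, and its coefficients at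
the variables divided by `m` form a solution. Conversely, a solution tells which tuple columns
cancel the constants. -/
theorem IsColumns.separated_iff {S : List Block} {B : ℕ} {cols : List (List (ZMod 3))}
    (H : IsColumns S B cols) (hB : ∀ b ∈ S, ∀ v ∈ b.1, v < B) (hS : ∀ b ∈ S, b.IsAffine) :
    Separated cols (width S) ↔ ∃ g : ℕ → ZMod 3, ∀ b ∈ S, b.1.map g ∈ b.2 := by
  constructor
  · rintro ⟨f, hf, h0, h1⟩
    have key : ∃ m y, Rep m y S f := by
      clear h0 h1
      induction hf using Submodule.span_induction with
      | mem f hf =>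
        obtain ⟨c, hc, rfl⟩ := hf
        obtain rfl | ⟨h, rfl⟩ | ⟨d, hd, rfl⟩ := H.sound c hc
        · exact ⟨_, _, rep_scopeCol 1 0 S⟩
        · exact ⟨_, _, rep_scopeCol 0 h S⟩
        · exact ⟨_, _, hd.rep hS⟩
      | zero => exact ⟨_, _, Rep.zero S⟩
      | add f g _ _ hf hg =>
        obtain ⟨m, y, hf⟩ := hf
        obtain ⟨n, z, hg⟩ := hg
        exact ⟨_, _, hf.add hg⟩
      | smul a f _ hf =>
        obtain ⟨m, y, hf⟩ := hf
        exact ⟨_, _, hf.smul a⟩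
    obtain ⟨m, y, hr⟩ := key
    exact ⟨_, hr.exists_map_mem (hr.apply_width ▸ h1) h0 hS⟩
  · rintro ⟨g, hg⟩
    have h1 : seq (scopeCol 1 g S ++ [0]) ∈ colSpan cols := by
      have := exists_shift_mem (V := colSpan cols) 0 (S := S) (fun d hd => ?_) g hg
      · convert! this using 1
      · convert! seq_mem_colSpan (H.tuple_mem d hd) using 1
    -- The constants, minus the tuples chosen by `g`, plus the variables weighted by `g`: all
    -- entries cancel except the last, which is 1.
    refine ⟨seq (scopeCol 1 0 S ++ [1]) - (seq (scopeCol 1 g S ++ [0]) -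
      seq (scopeCol 0 g S ++ [0])), sub_mem (seq_mem_colSpan H.const_mem)
        (sub_mem h1 (H.scopeCol_mem hB g)), ?_⟩
    have h2 := seq_scopeCol_add 1 0 0 g S 0 0
    simp only [add_zero, zero_add] at h2
    rw [h2, add_sub_cancel_right]
    constructor
    · intro i hi
      rw [Pi.sub_apply, seq_append_lt _ (by simpa using hi), seq_append_lt _ (by simpa using hi),
        sub_self]
    · have := fun l => seq_append_add (scopeCol 1 0 S) l 0
      simp only [length_scopeCol, zero_add] at this
      simp [this]

end AffineCSP

namespace AffineCSP

/-! ### Words describing systems, and the passes over them -/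

/-- The letters of the working alphabet: a constraint, an occurrence of a variable (followed by
its index in binary; it is marked as not live once its column has been written), binary digits,
a tuple, and its entries. -/
inductive Tok
  | con
  | var (live : Bool)
  | bit (b : Bool)
  | tup
  | val (z : ZMod 3)
  deriving DecidableEq, Fintype

/-- The purpose of a backward pass: to write the column of the constants, to write the column of
the variable whose index has just become negative, or to write the column of the last tuple (the
tuple is being searched, or it was found in this constraint, or in a later one). -/
inductive Mode
  | const
  | scope
  | search
  | found
  | done
  deriving DecidableEq

instance : Fintype Mode := ⟨{.const, .scope, .search, .found, .done}, by intro m; cases m <;> simp⟩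

/-- The mode of a backward pass after a letter. -/
def nextMode : Mode → Tok → Mode
  | .search, .tup => .found
  | .found, .con => .done
  | m, _ => m

/-- Whether only digits `1` have been read since the last marker. -/
def nextFlag : Bool → Tok → Bool
  | fl, .bit b => b && fl
  | _, _ => true

/-- The letter that a backward pass leaves in the place of a letter. -/
def keepTok : Mode → Bool → Tok → Option Tok
  | .scope, fl, .var l => some (.var (l && !fl))
  | .search, _, .tup => none
  | .search, _, .val _ => none
  | _, _, t => some t

/-- The entry of the column that a backward pass writes on reading a letter. -/
def emitVal : Mode → Bool → Tok → Option (ZMod 3)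
  | _, _, .bit _ => none
  | _, _, .tup => none
  | .search, _, .val z => some z
  | _, _, .val _ => none
  | .const, _, .con => some 1
  | .found, _, .con => some 1
  | _, _, .con => some 0
  | .found, _, .var _ => none
  | .scope, fl, .var l => some (if l && fl then 1 else 0)
  | _, _, .var _ => some 0

/-- A backward pass: the final state, the new word, and the column. -/
def bwd (m : Mode) : List Tok → (Mode × Bool) × List Tok × List (ZMod 3)
  | [] => ((m, true), [], [])
  | t :: T =>
      ((nextMode (bwd m T).1.1 t, nextFlag (bwd m T).1.2 t),
        (keepTok (bwd m T).1.1 (bwd m T).1.2 t).toList ++ (bwd m T).2.1,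
        (emitVal (bwd m T).1.1 (bwd m T).1.2 t).toList ++ (bwd m T).2.2)

/-- Whether a forward pass has to borrow from the next digit. -/
def fwdFlag : Mode → Bool → Tok → Bool
  | .scope, _, .var l => l
  | _, fl, .bit b => fl && !b
  | _, _, _ => false

/-- The letter that a forward pass writes. -/
def fwdTok : Bool → Tok → Tok
  | fl, .bit b => .bit (xor fl b)
  | _, t => t

/-- A forward pass, which decrements the indices of all live occurrences of variables. -/
def fwd (m : Mode) : Bool → List Tok → List Tok
  | _, [] => []
  | fl, t :: T => fwdTok fl t :: fwd m (fwdFlag m fl t) T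

lemma length_fwd (m : Mode) (fl : Bool) (T : List Tok) : (fwd m fl T).length = T.length := by
  induction T generalizing fl with
  | nil => rfl
  | cons t T ih => simp [fwd, ih]

lemma length_bwd_le (m : Mode) (T : List Tok) : (bwd m T).2.1.length ≤ T.length := by
  induction T with
  | nil => simp [bwd]
  | cons t T ih =>
    have : ∀ o : Option Tok, o.toList.length ≤ 1 := by rintro (_ | _) <;> simp
    have := this (keepTok (bwd m T).1.1 (bwd m T).1.2 t)
    simp only [bwd, List.length_append, List.length_cons]
    omega

/-- Decrement a binary numeral; zero becomes a numeral all of whose digits are `1`. -/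
def decr : List Bool → List Bool
  | [] => []
  | true :: w => false :: w
  | false :: w => true :: decr w

/-- The value of a binary numeral. -/
def value : List Bool → ℕ
  | [] => 0
  | b :: w => b.toNat + 2 * value w

/-- Together with the next lemma this makes underflow visible: decrementing at fixed length yields
only digits `1` exactly when the value was 0. The empty numeral, which encodes 0, is included. -/
lemma all_decr_of_value_eq_zero {w : List Bool} (h : value w = 0) : (decr w).all id = true := by
  induction w with
  | nil => rfl
  | cons b w ih =>
    cases b
    · simpa [decr] using ih (by simpa [value] using h)
    · simp [value] at h

lemma decr_of_value_ne_zero {w : List Bool} (h : value w ≠ 0) :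
    (decr w).all id = false ∧ value (decr w) + 1 = value w := by
  induction w with
  | nil => simp [value] at h
  | cons b w ih =>
    cases b
    · have := ih (by simpa [value] using h)
      simp only [decr, List.all_cons, value, this.1, Bool.and_false, Bool.toNat_true,
        Bool.toNat_false, true_and]
      omega
    · simp [decr, value, add_comm]

lemma value_encodePosNum (p : PosNum) : value (Computability.encodePosNum p) = (p : ℕ) := by
  induction p with
  | one => rfl
  | bit1 p ih => simp [Computability.encodePosNum, value, ih]; omega
  | bit0 p ih => simp [Computability.encodePosNum, value, ih]; omega

lemma value_encodeNat (n : ℕ) : value (Computability.encodeNat n) = n := by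
  conv_rhs => rw [← Num.to_of_nat n]
  rw [Computability.encodeNat]
  cases (n : Num) with
  | zero => rfl
  | pos p => exact value_encodePosNum p

/-- The effect of a forward pass on an occurrence of a variable. -/
def fwdNum (x : Bool × List Bool) : Bool × List Bool := (x.1, if x.1 then decr x.2 else x.2)

/-- The effect of a backward pass on an occurrence of a variable. -/
def bwdNum (x : Bool × List Bool) : Bool × List Bool := (x.1 && !x.2.all id, x.2)

/-- The entry of the column written for an occurrence of a variable. -/
def hit (x : Bool × List Bool) : ZMod 3 := if x.1 && x.2.all id then 1 else 0

/-- An occurrence of the variable `v` after `k` forward and backward passes. -/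
def num : ℕ → ℕ → Bool × List Bool
  | 0, v => (true, Computability.encodeNat v)
  | k + 1, v => bwdNum (fwdNum (num k v))

/-- An occurrence of `v` holds `v - k` while `k ≤ v`; the next round underflows when `k = v`, and
marks it as not live for good. -/
lemma num_spec (k v : ℕ) :
    (k ≤ v → (num k v).1 = true ∧ value (num k v).2 + k = v) ∧ (v < k → (num k v).1 = false) := by
  induction k with
  | zero => simp [num, value_encodeNat]
  | succ k ih =>
    constructor
    · intro h
      obtain ⟨h1, h2⟩ := ih.1 (by omega)
      have := decr_of_value_ne_zero (w := (num k v).2) (by omega)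
      simp only [num, bwdNum, fwdNum, h1, if_true, this.1]
      exact ⟨rfl, by omega⟩
    · intro h
      obtain h | rfl := Nat.lt_succ_iff_lt_or_eq.1 h
      · simp [num, bwdNum, fwdNum, ih.2 h]
      · obtain ⟨h1, h2⟩ := ih.1 le_rfl
        simp only [num, bwdNum, fwdNum, h1, if_true,
          all_decr_of_value_eq_zero (w := (num v v).2) (by omega)]
        rfl

/-- Underflow happens in round `k` for the variable `k` only; later rounds leave a dead numeral
alone, even though all its digits are `1`. -/
lemma hit_fwdNum_num (k v : ℕ) : hit (fwdNum (num k v)) = (Pi.single k 1 : ℕ → ZMod 3) v := by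
  obtain h | rfl | h := lt_trichotomy k v
  · obtain ⟨h1, h2⟩ := (num_spec k v).1 h.le
    have := decr_of_value_ne_zero (w := (num k v).2) (by omega)
    simp [hit, fwdNum, h1, this.1, h.ne']
  · obtain ⟨h1, h2⟩ := (num_spec k k).1 le_rfl
    simp only [hit, fwdNum, h1, if_true, Pi.single_eq_same,
      all_decr_of_value_eq_zero (w := (num k k).2) (by omega)]
    rfl
  · simp [hit, fwdNum, (num_spec k v).2 h, h.ne]

/-- The word describing an occurrence of a variable. -/
def numWord (x : Bool × List Bool) : List Tok := Tok.var x.1 :: x.2.map Tok.bit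

/-- The word describing a tuple. -/
def tupleWord (t : List (ZMod 3)) : List Tok := Tok.tup :: t.map Tok.val

/-- The word describing a system, where `f` gives the occurrences of variables. -/
def word (f : ℕ → Bool × List Bool) : List Block → List Tok
  | [] => []
  | b :: S =>
      Tok.con :: ((b.1.flatMap fun v => numWord (f v)) ++ (b.2.flatMap tupleWord ++ word f S))

/-- Borrowing starts only in the mode `scope`; otherwise the forward pass merely carries the word
back to the other stack. -/
lemma fwd_of_ne_scope {m : Mode} (hm : m ≠ .scope) (T : List Tok) : fwd m false T = T := by
  induction T with
  | nil => rfl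
  | cons t T ih =>
    have h1 : fwdTok false t = t := by cases t <;> simp [fwdTok]
    have h2 : fwdFlag m false t = false := by cases m <;> cases t <;> simp [fwdFlag] at hm ⊢
    rw [fwd, h1, h2, ih]

lemma fwd_bits_false (w : List Bool) (T : List Tok) :
    fwd .scope false (w.map Tok.bit ++ T) = w.map Tok.bit ++ fwd .scope false T := by
  induction w with
  | nil => rfl
  | cons b w ih => simp [fwd, fwdTok, fwdFlag, ih]

/-- A borrow beyond the last digit is lost, since the letter after a numeral is a marker; hence the
assumption that the rest is treated alike under both flags. -/
lemma fwd_bits_true {w : List Bool} {T T' : List Tok} (hT : ∀ fl, fwd .scope fl T = T') :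
    fwd .scope true (w.map Tok.bit ++ T) = (decr w).map Tok.bit ++ T' := by
  induction w with
  | nil => exact hT true
  | cons b w ih =>
    cases b
    · simp [fwd, fwdTok, fwdFlag, decr, ih]
    · simp [fwd, fwdTok, fwdFlag, decr, fwd_bits_false, hT]

lemma fwd_numWord {T T' : List Tok} (x : Bool × List Bool) (hT : ∀ fl, fwd .scope fl T = T')
    (fl : Bool) : fwd .scope fl (numWord x ++ T) = numWord (fwdNum x) ++ T' := by
  obtain ⟨l, w⟩ := x
  cases l
  · simp [numWord, fwdNum, fwd, fwdTok, fwdFlag, fwd_bits_false, hT]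
  · simp [numWord, fwdNum, fwd, fwdTok, fwdFlag, fwd_bits_true hT]

lemma fwd_numWords {T T' : List Tok} (f : ℕ → Bool × List Bool) (vs : List ℕ)
    (hT : ∀ fl, fwd .scope fl T = T') (fl : Bool) :
    fwd .scope fl ((vs.flatMap fun v => numWord (f v)) ++ T) =
      (vs.flatMap fun v => numWord (fwdNum (f v))) ++ T' := by
  induction vs generalizing fl with
  | nil => exact hT fl
  | cons v vs ih =>
    simp only [List.flatMap_cons, List.append_assoc]
    exact fwd_numWord _ ih fl

lemma fwd_vals {T T' : List Tok} (t : List (ZMod 3)) (hT : ∀ fl, fwd .scope fl T = T')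
    (fl : Bool) : fwd .scope fl (t.map Tok.val ++ T) = t.map Tok.val ++ T' := by
  induction t generalizing fl with
  | nil => exact hT fl
  | cons z t ih => simp [fwd, fwdTok, ih]

lemma fwd_tupleWords {T T' : List Tok} (ts : List (List (ZMod 3)))
    (hT : ∀ fl, fwd .scope fl T = T') (fl : Bool) :
    fwd .scope fl (ts.flatMap tupleWord ++ T) = ts.flatMap tupleWord ++ T' := by
  induction ts generalizing fl with
  | nil => exact hT fl
  | cons t ts ih =>
    simp [tupleWord, fwd, fwdTok, fwd_vals t ih]

lemma fwd_word (f : ℕ → Bool × List Bool) (S : List Block) (fl : Bool) :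
    fwd .scope fl (word f S) = word (fun v => fwdNum (f v)) S := by
  induction S generalizing fl with
  | nil => rfl
  | cons b S ih =>
    simp [word, fwd, fwdTok, fwd_numWords f b.1 (fwd_tupleWords b.2 ih)]

section Backward

variable {m q : Mode} {T L : List Tok} {c : List (ZMod 3)}

lemma bwd_bits (h : bwd m T = ((q, true), L, c)) (w : List Bool) :
    bwd m (w.map Tok.bit ++ T) = ((q, w.all id), w.map Tok.bit ++ L, c) := by
  induction w with
  | nil => exact h
  | cons b w ih => cases q <;> simp [bwd, ih, nextMode, nextFlag, keepTok, emitVal]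

lemma bwd_numWord (h : bwd m T = ((q, true), L, c)) (hq : q ≠ .scope) (hq' : q ≠ .found)
    (x : Bool × List Bool) : bwd m (numWord x ++ T) = ((q, true), numWord x ++ L, 0 :: c) := by
  cases q <;> simp_all [numWord, bwd, bwd_bits h, nextMode, nextFlag, keepTok, emitVal]

/-- In the constraint of the deleted tuple, the values of the tuple have already filled the entries
of the scope, so the scope must write nothing. -/
lemma bwd_numWord_found (h : bwd m T = ((.found, true), L, c)) (x : Bool × List Bool) :
    bwd m (numWord x ++ T) = ((.found, true), numWord x ++ L, c) := by
  simp [numWord, bwd, bwd_bits h, nextMode, nextFlag, keepTok, emitVal]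

lemma bwd_numWord_scope (h : bwd m T = ((.scope, true), L, c)) (x : Bool × List Bool) :
    bwd m (numWord x ++ T) = ((.scope, true), numWord (bwdNum x) ++ L, hit x :: c) := by
  simp only [numWord, List.cons_append, bwd, bwd_bits h, nextMode, nextFlag, keepTok, emitVal,
    bwdNum, hit]
  rfl

lemma bwd_numWords (h : bwd m T = ((q, true), L, c)) (hq : q ≠ .scope) (hq' : q ≠ .found)
    (f : ℕ → Bool × List Bool) (vs : List ℕ) :
    bwd m ((vs.flatMap fun v => numWord (f v)) ++ T) =
      ((q, true), (vs.flatMap fun v => numWord (f v)) ++ L, vs.map 0 ++ c) := by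
  induction vs with
  | nil => exact h
  | cons v vs ih => simp [bwd_numWord ih hq hq']

lemma bwd_numWords_found (h : bwd m T = ((.found, true), L, c)) (f : ℕ → Bool × List Bool)
    (vs : List ℕ) :
    bwd m ((vs.flatMap fun v => numWord (f v)) ++ T) =
      ((.found, true), (vs.flatMap fun v => numWord (f v)) ++ L, c) := by
  induction vs with
  | nil => exact h
  | cons v vs ih => simp [bwd_numWord_found ih]

lemma bwd_numWords_scope (h : bwd m T = ((.scope, true), L, c)) (f : ℕ → Bool × List Bool)
    (vs : List ℕ) :
    bwd m ((vs.flatMap fun v => numWord (f v)) ++ T) =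
      ((.scope, true), (vs.flatMap fun v => numWord (bwdNum (f v))) ++ L,
        vs.map (fun v => hit (f v)) ++ c) := by
  induction vs with
  | nil => exact h
  | cons v vs ih => simp [bwd_numWord_scope ih]

lemma bwd_vals (h : bwd m T = ((q, true), L, c)) (hq : q ≠ .search) (t : List (ZMod 3)) :
    bwd m (t.map Tok.val ++ T) = ((q, true), t.map Tok.val ++ L, c) := by
  induction t with
  | nil => exact h
  | cons z t ih => cases q <;> simp_all [bwd, nextMode, nextFlag, keepTok, emitVal]

lemma bwd_tupleWords (h : bwd m T = ((q, true), L, c)) (hq : q ≠ .search)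
    (ts : List (List (ZMod 3))) :
    bwd m (ts.flatMap tupleWord ++ T) = ((q, true), ts.flatMap tupleWord ++ L, c) := by
  induction ts with
  | nil => exact h
  | cons t ts ih =>
    have := bwd_vals ih hq t
    cases q <;> simp_all [tupleWord, bwd, nextMode, nextFlag, keepTok, emitVal]

lemma bwd_vals_search (h : bwd m T = ((.search, true), L, c)) (t : List (ZMod 3)) :
    bwd m (t.map Tok.val ++ T) = ((.search, true), L, t ++ c) := by
  induction t with
  | nil => exact h
  | cons z t ih => simp [bwd, ih, nextMode, nextFlag, keepTok, emitVal]

lemma bwd_tupleWord_search (h : bwd m T = ((.search, true), L, c)) (t : List (ZMod 3)) :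
    bwd m (tupleWord t ++ T) = ((.found, true), L, t ++ c) := by
  simp [tupleWord, bwd, bwd_vals_search h, nextMode, nextFlag, keepTok, emitVal]

end Backward

lemma bwd_const_word (f : ℕ → Bool × List Bool) (S : List Block) :
    bwd .const (word f S) = ((.const, true), word f S, scopeCol 1 0 S) := by
  induction S with
  | nil => rfl
  | cons b S ih =>
    have := bwd_numWords (bwd_tupleWords ih (by simp) b.2) (by simp) (by simp) f b.1
    simp [word, scopeCol, bwd, this, nextMode, nextFlag, keepTok, emitVal]

lemma bwd_scope_word (f : ℕ → Bool × List Bool) (S : List Block) :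
    bwd .scope (word f S) =
      ((.scope, true), word (fun v => bwdNum (f v)) S, scopeCol 0 (fun v => hit (f v)) S) := by
  induction S with
  | nil => rfl
  | cons b S ih =>
    have := bwd_numWords_scope (bwd_tupleWords ih (by simp) b.2) f b.1
    simp [word, scopeCol, bwd, this, nextMode, nextFlag, keepTok, emitVal]

/-- The number of tuples of a system. -/
def tupleCount : List Block → ℕ
  | [] => 0
  | b :: S => b.2.length + tupleCount S

lemma TupleCol.tupleCount_pos {S : List Block} {c : List (ZMod 3)} (h : TupleCol S c) :
    0 < tupleCount S := by
  induction h with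
  | here ht =>
    have := List.length_pos_of_mem ht
    simp only [tupleCount]
    omega
  | there _ ih => simp only [tupleCount]; omega

/-- This covers both the constraints behind the last tuple and the surplus passes after all tuples
are gone. -/
lemma bwd_search_word_of_tupleCount_eq_zero (f : ℕ → Bool × List Bool) {S : List Block}
    (hS : tupleCount S = 0) :
    bwd .search (word f S) = ((.search, true), word f S, scopeCol 0 0 S) := by
  induction S with
  | nil => rfl
  | cons b S ih =>
    simp only [tupleCount, Nat.add_eq_zero_iff, List.length_eq_zero_iff] at hS
    have := bwd_numWords (ih hS.2) (by simp) (by simp) f b.1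
    simp [word, scopeCol, hS.1, bwd, this, nextMode, nextFlag, keepTok, emitVal]

lemma scopeCol_congr (e : ZMod 3) (h : ℕ → ZMod 3) {S S' : List Block}
    (H : S'.map Prod.fst = S.map Prod.fst) : scopeCol e h S' = scopeCol e h S := by
  induction S generalizing S' with
  | nil =>
    obtain rfl : S' = [] := by simpa using H
    rfl
  | cons b S ih =>
    obtain _ | ⟨b', S'⟩ := S'
    · simp at H
    · simp only [List.map_cons, List.cons.injEq] at H
      rw [scopeCol, scopeCol, H.1, ih H.2]

/-- The system `S'` arises from `S` by deleting the last tuple, whose column is `d`. -/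
structure Deletes (S S' : List Block) (d : List (ZMod 3)) : Prop where
  bwd_word : ∀ f, ∃ q, bwd .search (word f S) = ((q, true), word f S', d)
  map_fst : S'.map Prod.fst = S.map Prod.fst
  col : TupleCol S d ∨ d = scopeCol 0 0 S
  tupleCol_of : ∀ e, TupleCol S' e → TupleCol S e
  of_tupleCol : ∀ e, TupleCol S e → TupleCol S' e ∨ e = d
  tupleCount_le : tupleCount S' ≤ tupleCount S - 1

/-- Reading backwards, the first tuple met is the last one of the last constraint that has any. The
induction distinguishes whether a later constraint still has a tuple, in which case the present one
contributes zeros, or the tuple is found here. -/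
lemma exists_bwd_search_word {S : List Block} (hS : 0 < tupleCount S) :
    ∃ S' d, (∀ f, bwd .search (word f S) = ((.done, true), word f S', d)) ∧
      S'.map Prod.fst = S.map Prod.fst ∧ TupleCol S d ∧ (∀ e, TupleCol S' e → TupleCol S e) ∧
      (∀ e, TupleCol S e → TupleCol S' e ∨ e = d) ∧ tupleCount S' + 1 = tupleCount S := by
  induction S with
  | nil => simp [tupleCount] at hS
  | cons b S ih =>
    obtain ⟨vs, ts⟩ := b
    by_cases h0 : 0 < tupleCount S
    · obtain ⟨S', d, h1, h2, h3, h4, h5, h6⟩ := ih h0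
      refine ⟨(vs, ts) :: S', 0 :: vs.map 0 ++ d, fun f => ?_, by simp [h2], .there h3, ?_, ?_, ?_⟩
      · have := bwd_numWords (bwd_tupleWords (h1 f) (by simp) ts) (by simp) (by simp) f vs
        simp [word, bwd, this, nextMode, nextFlag, keepTok, emitVal]
      · rintro e (h | h)
        · rw [scopeCol_congr 0 0 h2]
          exact .here h
        · exact .there (h4 _ h)
      · rintro e (h | h)
        · rw [← scopeCol_congr 0 0 h2]
          exact .inl (.here h)
        · exact (h5 _ h).imp .there fun h => by rw [h]
      · simp only [tupleCount]
        omega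
    · replace h0 : tupleCount S = 0 := by omega
      obtain rfl | ⟨ts, t, rfl⟩ := ts.eq_nil_or_concat'
      · simp [tupleCount, h0] at hS
      refine ⟨(vs, ts) :: S, 1 :: t ++ scopeCol 0 0 S, fun f => ?_, rfl, .here (by simp), ?_, ?_, ?_⟩
      · have := bwd_numWords_found (bwd_tupleWords (bwd_tupleWord_search
          (bwd_search_word_of_tupleCount_eq_zero f h0) t) (by simp) ts) f vs
        simp [word, bwd, this, nextMode, nextFlag, keepTok, emitVal]
      · rintro e (h | h)
        · exact .here (by simp [h])
        · exact .there h
      · rintro e (h | h)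
        · obtain h | h := List.mem_append.1 h
          · exact .inl (.here h)
          · obtain rfl := List.mem_singleton.1 h
            exact .inr rfl
        · exact absurd h.tupleCount_pos (by omega)
      · simp only [tupleCount, List.length_append, List.length_singleton]
        omega

/-- If no tuple is left, nothing is deleted and the column written is zero. -/
lemma exists_deletes (S : List Block) : ∃ S' d, Deletes S S' d := by
  by_cases h0 : 0 < tupleCount S
  · obtain ⟨S', d, h1, h2, h3, h4, h5, h6⟩ := exists_bwd_search_word h0
    exact ⟨S', d, fun f => ⟨_, h1 f⟩, h2, .inl h3, h4, h5, by omega⟩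
  · exact ⟨S, _, fun f => ⟨_, bwd_search_word_of_tupleCount_eq_zero f (by omega)⟩, rfl, .inr rfl,
      fun _ h => h, fun _ h => .inl h, by omega⟩

/-- The columns written, and the system left, after the column of the constants, and `k` columns
each of variables and tuples. -/
structure Partway (S₀ : List Block) (B k : ℕ) (S : List Block) (cols : List (List (ZMod 3))) :
    Prop where
  map_fst : S.map Prod.fst = S₀.map Prod.fst
  tupleCol_of : ∀ e, TupleCol S e → TupleCol S₀ e
  of_tupleCol : ∀ e, TupleCol S₀ e → TupleCol S e ∨ e ++ [0] ∈ cols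
  tupleCount_le : tupleCount S ≤ B - k
  sound : ∀ c ∈ cols, c = scopeCol 1 0 S₀ ++ [1] ∨ (∃ h, c = scopeCol 0 h S₀ ++ [0]) ∨
    ∃ d, TupleCol S₀ d ∧ c = d ++ [0]
  const_mem : scopeCol 1 0 S₀ ++ [1] ∈ cols
  var_mem : ∀ v < k, scopeCol 0 (Pi.single v 1) S₀ ++ [0] ∈ cols

lemma Partway.init {S : List Block} {B : ℕ} (hB : tupleCount S ≤ B) :
    Partway S B 0 S [scopeCol 1 0 S ++ [1]] where
  map_fst := rfl
  tupleCol_of _ h := h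
  of_tupleCol _ h := .inl h
  tupleCount_le := hB
  sound := by simp
  const_mem := by simp
  var_mem := by simp

lemma Partway.step {S₀ S S' : List Block} {B k : ℕ} {cols : List (List (ZMod 3))}
    {d : List (ZMod 3)} (h : Partway S₀ B k S cols) (hd : Deletes S S' d) :
    Partway S₀ B (k + 1) S'
      ((d ++ [0]) :: (scopeCol 0 (Pi.single k 1) S ++ [0]) :: cols) where
  map_fst := hd.map_fst.trans h.map_fst
  tupleCol_of e he := h.tupleCol_of e (hd.tupleCol_of e he)
  of_tupleCol e he := by
    obtain he | he := h.of_tupleCol e he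
    · obtain he | rfl := hd.of_tupleCol e he
      · exact .inl he
      · exact .inr (by simp)
    · exact .inr (by simp [he])
  tupleCount_le := by
    have := hd.tupleCount_le
    have := h.tupleCount_le
    omega
  sound c hc := by
    simp only [List.mem_cons] at hc
    obtain rfl | rfl | hc := hc
    · obtain hd | rfl := hd.col
      · exact .inr (.inr ⟨d, h.tupleCol_of _ hd, rfl⟩)
      · exact .inr (.inl ⟨0, by rw [scopeCol_congr _ _ h.map_fst]⟩)
    · exact .inr (.inl ⟨_, by rw [scopeCol_congr _ _ h.map_fst]⟩)
    · exact h.sound c hc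
  const_mem := by simp [h.const_mem]
  var_mem v hv := by
    obtain hv | rfl := Nat.lt_succ_iff_lt_or_eq.1 hv
    · simp [h.var_mem v hv]
    · simp [scopeCol_congr _ _ h.map_fst]

/-- After `B` rounds at most `B - B = 0` tuples remain, so every tuple column has been written. -/
lemma Partway.isColumns {S₀ S : List Block} {B : ℕ} {cols : List (List (ZMod 3))}
    (h : Partway S₀ B B S cols) : IsColumns S₀ B cols where
  sound := h.sound
  const_mem := h.const_mem
  var_mem := h.var_mem
  tuple_mem d hd := (h.of_tupleCol d hd).resolve_left fun hd => by
    have := hd.tupleCount_pos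
    have := h.tupleCount_le
    omega

end AffineCSP

namespace AffineCSP

open Turing

/-! ### The machine -/

/-- The stacks: input, output, the two sides of the working word, the modes of the passes still to
be made, the matrix and its reversal, the pivot and its reversal. -/
inductive Stk
  | inp | out | right | left | todo | mat | tam | piv | vip
  deriving DecidableEq

instance : Fintype Stk :=
  ⟨{.inp, .out, .right, .left, .todo, .mat, .tam, .piv, .vip}, by intro k; cases k <;> simp⟩

/-- The labels of the program. -/
inductive Label
  | read | back | next | forth | round | column | reduce | pivot | restore | clear | flip | check
  | clean
  deriving DecidableEq

instance : Fintype Label :=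
  ⟨{.read, .back, .next, .forth, .round, .column, .reduce, .pivot, .restore, .clear, .flip, .check,
    .clean}, by intro k; cases k <;> simp⟩

/-- An entry of the matrix, with a mark at the last entry of each column. -/
abbrev Entry := Bool × ZMod 3

/-- The alphabets of the stacks. -/
@[reducible] def Alphabet (X : Type) : Stk → Type
  | .inp => X
  | .out => Bool
  | .right => Tok
  | .left => Tok
  | .todo => Mode
  | .mat => Entry
  | .tam => Entry
  | .piv => Entry
  | .vip => Entry

/-- The internal states: those of the passes, the coefficient and the head of the pivot in an
elimination step, the answer, and buffers for letters taken from the stacks. -/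
structure St where
  mode : Mode := .const
  flag : Bool := true
  coef : ZMod 3 := 0
  lead : ZMod 3 := 0
  ans : Bool := false
  more : Bool := false
  inBuf : Option (Option Tok) := none
  tok : Option Tok := none
  todo : Option Mode := none
  ent : Option Entry := none
  ent' : Option Entry := none

noncomputable instance : Fintype St :=
  Fintype.ofInjective (fun s => (s.mode, s.flag, s.coef, s.lead, s.ans, s.more, s.inBuf, s.tok,
    s.todo, s.ent, s.ent')) fun s t h => by
      cases s
      cases t
      simpa using h

open TM2.Stmt in
/-- The program. -/
def program {X : Type} (tokOf : X → Option Tok) : Label → TM2.Stmt (Alphabet X) Label St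
  | .read =>
      pop .inp (fun s o => { s with inBuf := o.map tokOf }) <|
      branch (fun s => s.inBuf.isSome)
        (branch (fun s => s.inBuf.join.isSome)
          (push .right (fun s => s.inBuf.join.getD .con) <|
            -- Two passes are scheduled per input letter, even a letter that is dropped; `scope`
            -- lies on top and is performed first.
            push .todo (fun _ => .search) <| push .todo (fun _ => .scope) <|
            load (fun _ => {}) <| goto fun _ => .read)
          (push .todo (fun _ => .search) <| push .todo (fun _ => .scope) <|
            load (fun _ => {}) <| goto fun _ => .read))
        -- The first column is that of the constants, so its last coordinate is 1. It is pushed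
        -- first because a column is written from its end.
        (push .mat (fun _ => (true, 1)) <| load (fun _ => {}) <| goto fun _ => .back)
  | .back =>
      pop .right (fun s o => { s with tok := o }) <|
      branch (fun s => s.tok.isSome)
        (branch (fun s => (emitVal s.mode s.flag (s.tok.getD .con)).isSome)
          (push .mat (fun s => (false, (emitVal s.mode s.flag (s.tok.getD .con)).getD 0)) <|
            branch (fun s => (keepTok s.mode s.flag (s.tok.getD .con)).isSome)
            (push .left (fun s => (keepTok s.mode s.flag (s.tok.getD .con)).getD .con) <|
              load (fun s => { mode := nextMode s.mode (s.tok.getD .con),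
                               flag := nextFlag s.flag (s.tok.getD .con) }) <| goto fun _ => .back)
            (load (fun s => { mode := nextMode s.mode (s.tok.getD .con),
                              flag := nextFlag s.flag (s.tok.getD .con) }) <| goto fun _ => .back))
          (branch (fun s => (keepTok s.mode s.flag (s.tok.getD .con)).isSome)
            (push .left (fun s => (keepTok s.mode s.flag (s.tok.getD .con)).getD .con) <|
              load (fun s => { mode := nextMode s.mode (s.tok.getD .con),
                               flag := nextFlag s.flag (s.tok.getD .con) }) <| goto fun _ => .back)
            (load (fun s => { mode := nextMode s.mode (s.tok.getD .con),
                              flag := nextFlag s.flag (s.tok.getD .con) }) <| goto fun _ => .back)))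
        (load (fun _ => {}) <| goto fun _ => .next)
  | .next =>
      pop .todo (fun s o => { s with todo := o }) <|
      branch (fun s => s.todo.isSome)
        (load (fun s => { mode := s.todo.getD .const, flag := false }) <| goto fun _ => .forth)
        (load (fun _ => {}) <| goto fun _ => .round)
  | .forth =>
      pop .left (fun s o => { s with tok := o }) <|
      branch (fun s => s.tok.isSome)
        (push .right (fun s => fwdTok s.flag (s.tok.getD .con)) <|
          load (fun s => { mode := s.mode, flag := fwdFlag s.mode s.flag (s.tok.getD .con) }) <|
          goto fun _ => .forth)
        (push .mat (fun _ => (true, 0)) <| load (fun s => { mode := s.mode }) <|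
          goto fun _ => .back)
  | .round =>
      peek .mat (fun s o => { s with ent := o }) <|
      branch (fun s => s.ent.isSome)
        -- A mark on the first entry means that the columns have length 1.
        (branch (fun s => (s.ent.getD 0).1)
          (load (fun _ => {}) <| goto fun _ => .check)
          (load (fun _ => {}) <| goto fun _ => .column))
        (load (fun _ => {}) <| goto fun _ => .clean)
  | .column =>
      pop .mat (fun s o => { s with ent := o }) <|
      branch (fun s => s.ent.isSome)
        (branch (fun s => s.lead = 0 ∧ (s.ent.getD 0).2 ≠ 0)
          (load (fun s => { lead := (s.ent.getD 0).2 }) <| goto fun _ => .pivot)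
          (load (fun s => { lead := s.lead, coef := (s.ent.getD 0).2 * s.lead⁻¹ }) <|
            goto fun _ => .reduce))
        (load (fun _ => {}) <| goto fun _ => .clear)
  | .reduce =>
      pop .mat (fun s o => { s with ent := o }) <|
      pop .piv (fun s o => { s with ent' := o }) <|
      -- Without a pivot the default entry 0 is subtracted.
      push .tam (fun s => ((s.ent.getD 0).1, (s.ent.getD 0).2 - s.coef * (s.ent'.getD 0).2)) <|
      branch (fun s => s.ent'.isSome)
        (push .vip (fun s => s.ent'.getD 0) <|
          branch (fun s => (s.ent.getD 0).1)
            (load (fun s => { lead := s.lead }) <| goto fun _ => .restore)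
            (load (fun s => { lead := s.lead, coef := s.coef }) <| goto fun _ => .reduce))
        (branch (fun s => (s.ent.getD 0).1)
            (load (fun s => { lead := s.lead }) <| goto fun _ => .restore)
            (load (fun s => { lead := s.lead, coef := s.coef }) <| goto fun _ => .reduce))
  | .pivot =>
      pop .mat (fun s o => { s with ent := o }) <|
      push .vip (fun s => s.ent.getD 0) <|
      branch (fun s => (s.ent.getD 0).1)
        (load (fun s => { lead := s.lead }) <| goto fun _ => .restore)
        (load (fun s => { lead := s.lead }) <| goto fun _ => .pivot)
  | .restore =>
      pop .vip (fun s o => { s with ent := o }) <|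
      branch (fun s => s.ent.isSome)
        (push .piv (fun s => s.ent.getD 0) <|
          load (fun s => { lead := s.lead }) <| goto fun _ => .restore)
        (load (fun s => { lead := s.lead }) <| goto fun _ => .column)
  | .clear =>
      pop .piv (fun s o => { s with ent := o }) <|
      branch (fun s => s.ent.isSome)
        (load (fun _ => {}) <| goto fun _ => .clear)
        (load (fun _ => {}) <| goto fun _ => .flip)
  | .flip =>
      pop .tam (fun s o => { s with ent := o }) <|
      branch (fun s => s.ent.isSome)
        (push .mat (fun s => s.ent.getD 0) <| load (fun _ => {}) <| goto fun _ => .flip)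
        (load (fun _ => {}) <| goto fun _ => .round)
  | .check =>
      pop .mat (fun s o => { s with ent := o }) <|
      branch (fun s => s.ent.isSome)
        (branch (fun s => (s.ent.getD 0).2 = 0)
          (load (fun _ => {}) <| goto fun _ => .check)
          (load (fun _ => { ans := true }) <| goto fun _ => .clean))
        (load (fun _ => {}) <| goto fun _ => .clean)
  | .clean =>
      -- A halting configuration must have all stacks but the output empty, so the leftovers are
      -- discarded.
      pop .left (fun s o => { s with more := o.isSome }) <|
      pop .mat (fun s o => { s with more := s.more || o.isSome }) <|
      branch (fun s => s.more)
        (load (fun s => { ans := s.ans }) <| goto fun _ => .clean)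
        (push .out (fun s => s.ans) <| load (fun _ => {}) halt)

/-! ### Runs of the machine with time bounds -/

section Run

variable {X : Type}

/-- The contents of the stacks. -/
def contents (i : List X) (o : List Bool) (r l : List Tok) (t : List Mode)
    (m m' p p' : List Entry) : ∀ k, List (Alphabet X k)
  | .inp => i
  | .out => o
  | .right => r
  | .left => l
  | .todo => t
  | .mat => m
  | .tam => m'
  | .piv => p
  | .vip => p'

/-- A configuration of the machine. -/
def conf (q : Option Label) (s : St) (i : List X) (o : List Bool) (r l : List Tok) (t : List Mode)
    (m m' p p' : List Entry) : TM2.Cfg (Alphabet X) Label St :=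
  ⟨q, s, contents i o r l t m m' p p'⟩

variable (tokOf : X → Option Tok)

/-- The machine gets from one configuration to another in at most `n` steps. -/
def Within (n : ℕ) (c c' : TM2.Cfg (Alphabet X) Label St) : Prop :=
  ∃ k ≤ n, (flip bind (TM2.step (program tokOf)))^[k] (some c) = some c'

variable {tokOf}

lemma Within.refl (c : TM2.Cfg (Alphabet X) Label St) : Within tokOf 0 c c := ⟨0, le_rfl, rfl⟩

lemma Within.mono {m n : ℕ} {c d : TM2.Cfg (Alphabet X) Label St} (h : Within tokOf m c d)
    (hmn : m ≤ n) : Within tokOf n c d := by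
  obtain ⟨k, hk, h⟩ := h
  exact ⟨k, hk.trans hmn, h⟩

lemma Within.trans {m n : ℕ} {c d e : TM2.Cfg (Alphabet X) Label St} (h : Within tokOf m c d)
    (h' : Within tokOf n d e) : Within tokOf (m + n) c e := by
  obtain ⟨k, hk, h⟩ := h
  obtain ⟨k', hk', h'⟩ := h'
  exact ⟨k' + k, by omega, by rw [Function.iterate_add_apply, h, h']⟩

lemma Within.of_step {c d : TM2.Cfg (Alphabet X) Label St}
    (h : TM2.step (program tokOf) c = some d) : Within tokOf 1 c d := ⟨1, le_rfl, h⟩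

lemma Within.cons {n : ℕ} {c d e : TM2.Cfg (Alphabet X) Label St}
    (h : TM2.step (program tokOf) c = some d) (h' : Within tokOf n d e) :
    Within tokOf (n + 1) c e := by
  rw [add_comm]
  exact (Within.of_step h).trans h'

variable (i : List X) (o : List Bool) (r l : List Tok) (t : List Mode) (m m' p p' : List Entry)

@[simp] lemma update_inp (x : List X) :
    Function.update (contents i o r l t m m' p p') .inp x = contents x o r l t m m' p p' := by
  funext k; cases k <;> rfl

@[simp] lemma update_out (x : List Bool) :
    Function.update (contents i o r l t m m' p p') .out x = contents i x r l t m m' p p' := by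
  funext k; cases k <;> rfl

@[simp] lemma update_right (x : List Tok) :
    Function.update (contents i o r l t m m' p p') .right x = contents i o x l t m m' p p' := by
  funext k; cases k <;> rfl

@[simp] lemma update_left (x : List Tok) :
    Function.update (contents i o r l t m m' p p') .left x = contents i o r x t m m' p p' := by
  funext k; cases k <;> rfl

@[simp] lemma update_todo (x : List Mode) :
    Function.update (contents i o r l t m m' p p') .todo x = contents i o r l x m m' p p' := by
  funext k; cases k <;> rfl

@[simp] lemma update_mat (x : List Entry) :
    Function.update (contents i o r l t m m' p p') .mat x = contents i o r l t x m' p p' := by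
  funext k; cases k <;> rfl

@[simp] lemma update_tam (x : List Entry) :
    Function.update (contents i o r l t m m' p p') .tam x = contents i o r l t m x p p' := by
  funext k; cases k <;> rfl

@[simp] lemma update_piv (x : List Entry) :
    Function.update (contents i o r l t m m' p p') .piv x = contents i o r l t m m' x p' := by
  funext k; cases k <;> rfl

@[simp] lemma update_vip (x : List Entry) :
    Function.update (contents i o r l t m m' p p') .vip x = contents i o r l t m m' p x := by
  funext k; cases k <;> rfl

/-- The letters of the input in the working alphabet, and the passes to be made. -/
lemma within_read :
    Within tokOf (i.length + 1) (conf (some .read) {} i o r l t m m' p p')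
      (conf (some .back) {} [] o ((i.filterMap tokOf).reverse ++ r) l
        ((List.replicate i.length [Mode.scope, Mode.search]).flatten ++ t) ((true, 1) :: m)
        m' p p') := by
  induction i generalizing r t with
  | nil =>
    refine Within.of_step ?_
    simp [conf, program, contents]
  | cons x i ih =>
    -- Passes are pushed in front of `t` but counted at the other end; all blocks being equal, this
    -- makes no difference.
    have hrep : ∀ n, (List.replicate n [Mode.scope, Mode.search]).flatten ++
        (.scope :: .search :: t) =
          (List.replicate (n + 1) [Mode.scope, Mode.search]).flatten ++ t := by
      intro n
      rw [List.replicate_succ', List.flatten_append]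
      simp
    cases hx : tokOf x with
    | none =>
      have := ih r (.scope :: .search :: t)
      rw [hrep] at this
      simp only [List.filterMap_cons, hx]
      refine Within.cons ?_ this
      simp [conf, program, contents, hx]
    | some y =>
      have := ih (y :: r) (.scope :: .search :: t)
      rw [hrep] at this
      simp only [List.filterMap_cons, hx, List.reverse_cons, List.append_assoc]
      refine Within.cons ?_ this
      simp [conf, program, contents, hx]

end Run

end AffineCSP

namespace AffineCSP

open Turing

section Run

variable {X : Type} {tokOf : X → Option Tok}

/-! ### Writing the matrix -/

variable (i : List X) (o : List Bool) (r l : List Tok) (t : List Mode) (m m' p p' : List Entry)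

lemma step_back (md : Mode) (fl : Bool) (x : Tok) :
    TM2.step (program tokOf)
      (conf (some .back) { mode := md, flag := fl } i o (x :: r) l t m m' p p') =
        some (conf (some .back) { mode := nextMode md x, flag := nextFlag fl x } i o r
          ((keepTok md fl x).toList ++ l) t
          ((emitVal md fl x).toList.map (fun z => (false, z)) ++ m) m' p p') := by
  cases h : keepTok md fl x <;> cases h' : emitVal md fl x <;>
    simp [conf, program, contents, h, h']

lemma within_back (md : Mode) (T : List Tok) :
    Within tokOf T.length
      (conf (some .back) { mode := md } i o (T.reverse ++ r) l t m m' p p')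
      (conf (some .back) { mode := (bwd md T).1.1, flag := (bwd md T).1.2 } i o r
        ((bwd md T).2.1 ++ l) t ((bwd md T).2.2.map (fun z => (false, z)) ++ m) m' p p') := by
  induction T generalizing r with
  | nil => exact Within.refl _
  | cons x T ih =>
    rw [List.reverse_cons, List.append_assoc]
    refine (ih (x :: r)).trans (Within.of_step ?_)
    rw [step_back]
    simp [bwd]

lemma within_forth (md : Mode) (fl : Bool) (T : List Tok) :
    Within tokOf (T.length + 1) (conf (some .forth) { mode := md, flag := fl } i o r T t m m' p p')
      (conf (some .back) { mode := md } i o ((fwd md fl T).reverse ++ r) [] t ((true, 0) :: m)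
        m' p p') := by
  induction T generalizing r fl with
  | nil =>
    refine Within.of_step ?_
    simp [conf, program, contents, fwd]
  | cons x T ih =>
    have := ih (fwdTok fl x :: r) (fwdFlag md fl x)
    refine Within.cons (d := conf (some .forth) { mode := md, flag := fwdFlag md fl x } i o
      (fwdTok fl x :: r) T t m m' p p') ?_ ?_
    · simp [conf, program, contents]
    · simpa [fwd] using this

/-- The entries of a column, the last of them marked. -/
def entries : List (ZMod 3) → List Entry
  | [] => []
  | [x] => [(true, x)]
  | x :: y :: v => (false, x) :: entries (y :: v)

lemma entries_append (c : List (ZMod 3)) (e : ZMod 3) :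
    entries (c ++ [e]) = c.map (fun z => (false, z)) ++ [(true, e)] := by
  induction c with
  | nil => rfl
  | cons x c ih =>
    cases c with
    | nil => rfl
    | cons y c => simpa [entries] using ih

@[simp] lemma length_entries (v : List (ZMod 3)) : (entries v).length = v.length := by
  induction v with
  | nil => rfl
  | cons x v ih => cases v <;> simp_all [entries]

lemma entries_cons {v : List (ZMod 3)} (hv : v ≠ []) (x : ZMod 3) :
    entries (x :: v) = (false, x) :: entries v := by
  cases v
  · exact absurd rfl hv
  · rfl

lemma within_pass (md : Mode) (T : List Tok) (cols : List (List (ZMod 3))) :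
    Within tokOf (2 * T.length + 3)
      (conf (some .next) {} i o [] T (md :: t) (cols.flatMap entries) m' p p')
      (conf (some .next) {} i o [] (bwd md (fwd md false T)).2.1 t
        (((bwd md (fwd md false T)).2.2 ++ [0]) :: cols |>.flatMap entries) m' p p') := by
  have h1 : TM2.step (program tokOf)
      (conf (some .next) {} i o [] T (md :: t) (cols.flatMap entries) m' p p') =
        some (conf (some .forth) { mode := md, flag := false } i o [] T t (cols.flatMap entries)
          m' p p') := by
    simp [conf, program, contents]
  have h2 := within_forth (tokOf := tokOf) i o [] t (cols.flatMap entries) m' p p' md false T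
  have h3 := within_back (tokOf := tokOf) i o [] [] t ((true, 0) :: cols.flatMap entries) m' p p' md
    (fwd md false T)
  rw [length_fwd] at h3
  refine ((Within.of_step h1).trans (h2.trans (h3.trans (Within.of_step (d := _) ?_)))).mono
    (by omega)
  simp [conf, program, contents, entries_append]

/-- Passes never lengthen the word, so `W` bounds it throughout, and a round of two passes costs `2
* (2 * W + 3)` steps. -/
lemma within_passes {S₀ : List Block} {B W : ℕ} (n : ℕ) {k : ℕ} (hk : k + n = B) {S : List Block}
    {cols : List (List (ZMod 3))} (h : Partway S₀ B k S cols) (hW : (word (num k) S).length ≤ W) :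
    ∃ T' cols' S', Partway S₀ B B S' cols' ∧ T'.length ≤ W ∧
      cols'.length = cols.length + 2 * n ∧
      Within tokOf (n * (4 * W + 6))
        (conf (some .next) {} i o [] (word (num k) S)
          (List.replicate n [Mode.scope, Mode.search]).flatten (cols.flatMap entries) m' p p')
        (conf (some .next) {} i o [] T' [] (cols'.flatMap entries) m' p p') := by
  induction n generalizing k S cols with
  | zero =>
    obtain rfl : k = B := by omega
    exact ⟨_, cols, S, h, hW, by simp, by simpa using Within.refl _⟩
  | succ n ih =>
    obtain ⟨S', d, hd⟩ := exists_deletes S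
    obtain ⟨q, hq⟩ := hd.bwd_word (num (k + 1))
    have h1 := within_pass (tokOf := tokOf) i o
      (.search :: (List.replicate n [Mode.scope, Mode.search]).flatten) m' p p' .scope
      (word (num k) S) cols
    have e1 : bwd .scope (fwd .scope false (word (num k) S)) =
        ((.scope, true), word (num (k + 1)) S, scopeCol 0 (Pi.single k 1) S) := by
      rw [fwd_word, bwd_scope_word]
      simp only [hit_fwdNum_num]
      rfl
    have l1 := length_bwd_le .scope (fwd .scope false (word (num k) S))
    rw [e1] at h1 l1
    have h2 := within_pass (tokOf := tokOf) i o
      (List.replicate n [Mode.scope, Mode.search]).flatten m' p p' .search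
      (word (num (k + 1)) S) ((scopeCol 0 (Pi.single k 1) S ++ [0]) :: cols)
    have l2 := length_bwd_le .search (word (num (k + 1)) S)
    rw [fwd_of_ne_scope (by simp), hq] at h2
    rw [hq] at l2
    rw [length_fwd] at l1
    simp only at l1 l2
    obtain ⟨T', cols', S'', h3, h4, h5, h6⟩ := ih (by omega) (h.step hd) (by omega)
    refine ⟨T', cols', S'', h3, h4, by rw [h5]; simp; ring, ?_⟩
    rw [List.replicate_succ, List.flatten_cons]
    refine (h1.trans (h2.trans h6)).mono ?_
    have : (n + 1) * (4 * W + 6) = n * (4 * W + 6) + (4 * W + 6) := by ring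
    omega

/-! ### Elimination -/

lemma within_restore (a : ZMod 3) :
    Within tokOf (p'.length + 1) (conf (some .restore) { lead := a } i o r l t m m' p p')
      (conf (some .column) { lead := a } i o r l t m m' (p'.reverse ++ p) []) := by
  induction p' generalizing p with
  | nil =>
    refine Within.of_step ?_
    simp [conf, program, contents]
  | cons x p' ih =>
    have := ih (x :: p)
    rw [List.reverse_cons, List.append_assoc]
    refine Within.cons ?_ this
    simp [conf, program, contents]

lemma within_clear :
    Within tokOf (p.length + 1) (conf (some .clear) {} i o r l t m m' p p')
      (conf (some .flip) {} i o r l t m m' [] p') := by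
  induction p with
  | nil =>
    refine Within.of_step ?_
    simp [conf, program, contents]
  | cons x p ih =>
    refine Within.cons ?_ ih
    simp [conf, program, contents]

lemma within_flip :
    Within tokOf (m'.length + 1) (conf (some .flip) {} i o r l t m m' p p')
      (conf (some .round) {} i o r l t (m'.reverse ++ m) [] p p') := by
  induction m' generalizing m with
  | nil =>
    refine Within.of_step ?_
    simp [conf, program, contents]
  | cons x m' ih =>
    have := ih (x :: m)
    rw [List.reverse_cons, List.append_assoc]
    refine Within.cons ?_ this
    simp [conf, program, contents]

lemma within_pivot (a : ZMod 3) {v : List (ZMod 3)} (hv : v ≠ []) :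
    Within tokOf v.length
      (conf (some .pivot) { lead := a } i o r l t (entries v ++ m) m' p p')
      (conf (some .restore) { lead := a } i o r l t m m' p ((entries v).reverse ++ p')) := by
  induction v generalizing p' with
  | nil => exact absurd rfl hv
  | cons x v ih =>
    cases v with
    | nil =>
      refine Within.of_step ?_
      simp [conf, program, contents, entries]
    | cons y v =>
      have := ih ((false, x) :: p') (by simp)
      rw [entries_cons (by simp), List.reverse_cons, List.append_assoc]
      refine Within.cons ?_ this
      simp [conf, program, contents]

lemma within_reduce (a c : ZMod 3) {v q : List (ZMod 3)} (hv : v ≠ [])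
    (hq : q = [] ∨ q.length = v.length) :
    Within tokOf v.length
      (conf (some .reduce) { lead := a, coef := c } i o r l t (entries v ++ m) m' (entries q) p')
      (conf (some .restore) { lead := a } i o r l t m ((entries (reduce c v q)).reverse ++ m') []
        ((entries q).reverse ++ p')) := by
  induction v generalizing q m' p' with
  | nil => exact absurd rfl hv
  | cons x v ih =>
    obtain rfl | hq := hq
    · cases v with
      | nil =>
        refine Within.of_step ?_
        simp [conf, program, contents, entries, reduce]
      | cons y v =>
        have := ih ((false, x) :: m') p' (by simp) (.inl rfl)
        rw [reduce_nil] at this ⊢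
        rw [entries_cons (by simp), List.reverse_cons, List.append_assoc]
        refine Within.cons ?_ this
        simp [conf, program, contents, entries]
    · obtain _ | ⟨z, q⟩ := q
      · simp at hq
      have hq : q.length = v.length := by simpa using hq
      cases v with
      | nil =>
        obtain rfl : q = [] := by simpa using hq
        refine Within.of_step ?_
        simp [conf, program, contents, entries, reduce]
      | cons y v =>
        have hq' : q ≠ [] := by rintro rfl; simp at hq
        have hr : reduce c (y :: v) q ≠ [] := by
          rw [ne_eq, ← List.length_eq_zero_iff, length_reduce]
          simp
        have := ih ((false, x - c * z) :: m') ((false, z) :: p') (by simp) (.inr hq)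
        rw [entries_cons (by simp), entries_cons hq', reduce, entries_cons hr, List.reverse_cons,
          List.reverse_cons, List.append_assoc, List.append_assoc]
        refine Within.cons ?_ this
        simp [conf, program, contents]

lemma within_columns {n : ℕ} {a : ZMod 3} {q : List (ZMod 3)} (haq : a = 0 → q = [])
    (hq : q = [] ∨ q.length = n + 1) {vs : List (List (ZMod 3))}
    (hvs : ∀ v ∈ vs, v.length = n + 2) :
    ∃ q', q'.length ≤ n + 1 ∧ Within tokOf (vs.length * (2 * n + 4) + 1)
      (conf (some .column) { lead := a } i o r l t (vs.flatMap entries) m' (entries q) [])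
      (conf (some .clear) {} i o r l t [] (((elim a q vs).flatMap entries).reverse ++ m')
        (entries q') []) := by
  induction vs generalizing a q m' with
  | nil =>
    refine ⟨q, by obtain rfl | hq := hq <;> simp_all, (Within.of_step ?_).mono (by simp)⟩
    simp [conf, program, contents, elim]
  | cons v vs ih =>
    have hvs' : ∀ w ∈ vs, w.length = n + 2 := fun w hw => hvs w (by simp [hw])
    obtain _ | ⟨x, v⟩ := v
    · simpa using hvs [] (by simp)
    have hv : v.length = n + 1 := by simpa using hvs (x :: v) (by simp)
    have hv0 : v ≠ [] := by rintro rfl; simp at hv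
    -- Per column: one step for its head, `n + 1` for its tail, and at most `n + 2` for restoring
    -- the pivot.
    have hlen : ((x :: v) :: vs).length * (2 * n + 4) + 1 =
        1 + ((n + 1) + ((n + 1 + 1) + (vs.length * (2 * n + 4) + 1))) := by
      simp only [List.length_cons]
      ring
    rw [elim, hlen]
    split_ifs with hx
    · obtain ⟨rfl, hx⟩ := hx
      obtain rfl := haq rfl
      obtain ⟨q', hq', h⟩ := ih (a := x) (q := v) m' (fun h => absurd h hx) (.inr hv) hvs'
      refine ⟨q', hq', ?_⟩
      have h1 := within_pivot (tokOf := tokOf) i o r l t (vs.flatMap entries) m' [] [] x hv0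
      have h2 := within_restore (tokOf := tokOf) i o r l t (vs.flatMap entries) m' []
        ((entries v).reverse ++ []) x
      simp only [List.append_nil, List.reverse_reverse, List.length_reverse, length_entries, hv]
        at h1 h2
      refine (Within.of_step ?_).trans (h1.trans (h2.trans h))
      simp [conf, program, contents, entries_cons hv0, hx, entries]
    · obtain ⟨q', hq', h⟩ := ih ((entries (reduce (x * a⁻¹) v q)).reverse ++ m') haq hq hvs'
      refine ⟨q', hq', ?_⟩
      have h1 := within_reduce (tokOf := tokOf) i o r l t (vs.flatMap entries) m' [] a (x * a⁻¹) hv0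
        (q := q) (hq.imp_right fun h => h.trans hv.symm)
      have h2 := within_restore (tokOf := tokOf) i o r l t (vs.flatMap entries)
        ((entries (reduce (x * a⁻¹) v q)).reverse ++ m') [] ((entries q).reverse ++ []) a
      simp only [List.append_nil, List.reverse_reverse, List.length_reverse, length_entries, hv]
        at h1 h2
      simp only [List.flatMap_cons, List.reverse_append, List.append_assoc]
      refine (Within.of_step ?_).trans (h1.trans ((h2.mono ?_).trans h))
      · have hx' : (decide (a = 0) && !decide (x = 0)) = false := by simpa using hx
        simp [conf, program, contents, entries_cons hv0, hx']
      · obtain rfl | hq := hq <;> simp_all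

lemma length_flatMap_entries {n : ℕ} {vs : List (List (ZMod 3))} (hvs : ∀ v ∈ vs, v.length = n) :
    (vs.flatMap entries).length = vs.length * n := by
  rw [List.length_flatMap, List.map_congr_left (g := fun _ => n) fun v hv => by simp [hvs v hv]]
  simp

lemma within_round {n : ℕ} {vs : List (List (ZMod 3))} (hne : vs ≠ [])
    (hvs : ∀ v ∈ vs, v.length = n + 2) :
    Within tokOf ((vs.length + 1) * (3 * n + 8))
      (conf (some .round) {} i o r l t (vs.flatMap entries) [] [] [])
      (conf (some .round) {} i o r l t ((elim 0 [] vs).flatMap entries) [] [] []) := by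
  obtain ⟨q', hq', h⟩ := within_columns (tokOf := tokOf) i o r l t [] (a := 0) (q := [])
    (fun _ => rfl) (.inl rfl) hvs
  have h1 := within_clear (tokOf := tokOf) i o r l t []
    (((elim 0 [] vs).flatMap entries).reverse ++ []) (entries q') []
  have h2 := within_flip (tokOf := tokOf) i o r l t []
    (((elim 0 [] vs).flatMap entries).reverse ++ []) [] []
  have h3 := length_flatMap_entries (length_of_mem_elim (a := 0) (p := []) hvs)
  simp only [List.append_nil, List.reverse_reverse, List.length_reverse, length_entries, h3]
    at h h1 h2
  refine ((Within.of_step ?_).trans (h.trans (h1.trans h2))).mono ?_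
  · obtain _ | ⟨v, vs⟩ := vs
    · exact absurd rfl hne
    obtain _ | ⟨x, v⟩ := v
    · simpa using hvs [] (by simp)
    have hv0 : v ≠ [] := by
      rintro rfl
      simpa using hvs [x] (by simp)
    have he : entries [] = [] := rfl
    simp [conf, program, contents, entries_cons hv0, he]
  · have h4 := Nat.mul_le_mul_right (n + 1) (length_elim_le 0 [] vs)
    have h5 : (vs.length + 1) * (3 * n + 8) =
      vs.length * (2 * n + 4) + vs.length * (n + 1) + 3 * vs.length + (3 * n + 8) := by ring
    omega

lemma within_check {vs : List (List (ZMod 3))} (hvs : ∀ v ∈ vs, v.length = 1) :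
    ∃ (b : Bool) (w : List Entry), (b = true ↔ ∃ v ∈ vs, seq v 0 ≠ 0) ∧ w.length ≤ vs.length ∧
      Within tokOf (vs.length + 1)
        (conf (some .check) {} i o r l t (vs.flatMap entries) m' p p')
        (conf (some .clean) { ans := b } i o r l t w m' p p') := by
  induction vs with
  | nil =>
    refine ⟨false, [], by simp, by simp, Within.of_step ?_⟩
    simp [conf, program, contents]
  | cons v vs ih =>
    obtain ⟨x, rfl⟩ := List.length_eq_one_iff.1 (hvs v (by simp))
    by_cases hx : x = 0
    · obtain ⟨b, w, hb, hw, h⟩ := ih fun w hw => hvs w (by simp [hw])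
      refine ⟨b, w, by simp [hb, hx], by simp; omega, Within.cons ?_ h⟩
      simp [conf, program, contents, entries, hx]
    · refine ⟨true, vs.flatMap entries, by simp [hx], ?_, (Within.of_step ?_).mono (by simp)⟩
      · rw [length_flatMap_entries (n := 1) fun w hw => hvs w (by simp [hw])]
        simp
      · simp [conf, program, contents, entries, hx]

lemma not_separated_nil (n : ℕ) : ¬ Separated [] n := by
  rintro ⟨f, hf, -, h⟩
  rw [mem_colSpan_nil] at hf
  simp [hf] at h

/-- Each round removes one coordinate and never adds a column, so `n + 1` rounds on at most `N`
columns suffice. -/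
lemma within_solve {n N : ℕ} {vs : List (List (ZMod 3))} (hvs : ∀ v ∈ vs, v.length = n + 1)
    (hN : vs.length ≤ N) :
    ∃ (b : Bool) (w : List Entry), (b = true ↔ Separated vs n) ∧ w.length ≤ N ∧
      Within tokOf ((n + 1) * ((N + 1) * (3 * n + 8)))
        (conf (some .round) {} i o r l t (vs.flatMap entries) [] [] [])
        (conf (some .clean) { ans := b } i o r l t w [] [] []) := by
  by_cases hne : vs = []
  · subst hne
    refine ⟨false, [], by simp [not_separated_nil], by simp, (Within.of_step ?_).mono ?_⟩
    · simp [conf, program, contents]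
    · exact Nat.succ_le_of_lt (by positivity)
  induction n generalizing vs with
  | zero =>
    obtain ⟨b, w, hb, hw, h⟩ := within_check (tokOf := tokOf) i o r l t [] [] [] hvs
    refine ⟨b, w, by rw [hb, separated_zero], hw.trans hN,
      ((Within.of_step ?_).trans h).mono (by omega)⟩
    obtain _ | ⟨v, vs⟩ := vs
    · exact absurd rfl hne
    obtain ⟨x, rfl⟩ := List.length_eq_one_iff.1 (hvs v (by simp))
    simp [conf, program, contents, entries]
  | succ n ih =>
    have h1 := within_round (tokOf := tokOf) i o r l t hne hvs
    have hvs' := length_of_mem_elim (a := 0) (p := []) hvs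
    have hN' := (length_elim_le 0 [] vs).trans hN
    -- The induction hypothesis excludes the empty matrix, which elimination may produce; the extra
    -- step leaves room for that case.
    have h2 : ∃ (b : Bool) (w : List Entry), (b = true ↔ Separated (elim 0 [] vs) n) ∧
        w.length ≤ N ∧ Within tokOf ((n + 1) * ((N + 1) * (3 * n + 8)) + 1)
        (conf (some .round) {} i o r l t ((elim 0 [] vs).flatMap entries) [] [] [])
        (conf (some .clean) { ans := b } i o r l t w [] [] []) := by
      by_cases hne' : elim 0 [] vs = []
      · rw [hne']
        refine ⟨false, [], by simp [not_separated_nil], by simp, (Within.of_step ?_).mono (by simp)⟩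
        simp [conf, program, contents]
      · obtain ⟨b, w, hb, hw, h⟩ := ih hvs' hN' hne'
        exact ⟨b, w, hb, hw, h.mono (by simp)⟩
    obtain ⟨b, w, hb, hw, h2⟩ := h2
    refine ⟨b, w, by rw [hb, separated_succ hvs], hw, (h1.trans h2).mono ?_⟩
    have h3 : (vs.length + 1) * (3 * n + 8) ≤ (N + 1) * (3 * n + 8) :=
      Nat.mul_le_mul_right _ (by omega)
    have h4 : (n + 1 + 1) * ((N + 1) * (3 * (n + 1) + 8)) =
        (n + 1) * ((N + 1) * (3 * n + 8)) + (N + 1) * (3 * n + 8) + 3 * ((n + 2) * (N + 1)) := by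
      ring
    have h5 : 0 < (n + 2) * (N + 1) := by positivity
    omega

lemma within_clean (b : Bool) (n : ℕ) (hl : l.length ≤ n) (hm : m.length ≤ n) :
    Within tokOf (n + 1) (conf (some .clean) { ans := b } i o r l t m m' p p')
      (conf none {} i (b :: o) r [] t [] m' p p') := by
  induction n generalizing l m with
  | zero =>
    obtain rfl : l = [] := by simpa using hl
    obtain rfl : m = [] := by simpa using hm
    refine Within.of_step ?_
    simp [conf, program, contents]
  | succ n ih =>
    by_cases h : l = [] ∧ m = []
    · obtain ⟨rfl, rfl⟩ := h
      exact (ih [] [] (by simp) (by simp)).mono (by omega)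
    · refine Within.cons ?_ (ih l.tail m.tail (by simp; omega) (by simp; omega))
      cases l <;> cases m <;> simp_all [conf, program, contents]

end Run

end AffineCSP

namespace AffineCSP

open Turing

/-! ### Instances whose solutions are determined modulo maps to `ZMod 3` -/

/-- Homomorphisms from the algebras of a collection to the Steiner quasigroup on `ZMod 3`, together
with a choice of one element in each fibre, that `x ↦ x * ((x * base) * base)` maps the fibre to,
and that is absorbing for `x ↦ x * ((x * y) * y)`. -/
structure Reduction {ι : Type} (A : ι → Type) [∀ i, Mul (A i)] where
  toZ : ∀ i, A i → ZMod 3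
  canon : ∀ i, ZMod 3 → A i
  base : ∀ i, A i
  toZ_mul : ∀ i x y, toZ i (x * y) = -(toZ i x + toZ i y)
  mul_base : ∀ i x, x * ((x * base i) * base i) = canon i (toZ i x)
  canon_mul : ∀ i x y, canon i (toZ i x) * ((canon i (toZ i x) * y) * y) = canon i (toZ i x)

namespace Reduction

variable {ι : Type} {A : ι → Type} [∀ i, Mul (A i)] (D : Reduction A)

/-- In the quasigroup `(x * y) * y = x` and `x * x = -2x = x`. -/
lemma toZ_mul_mul (i : ι) (x y : A i) : D.toZ i (x * ((x * y) * y)) = D.toZ i x := by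
  rw [D.toZ_mul, D.toZ_mul, D.toZ_mul]
  have h3 : (3 : ZMod 3) = 0 := rfl
  linear_combination (-D.toZ i x) * h3

/-- Coordinates are made canonical one at a time. For the coordinate `j`, subdirectness supplies a
tuple `y` with the base element at `j`. The term `x * ((x * y) * y)` then corrects `j`, preserves
all images in `ZMod 3`, and leaves the coordinates already canonical unchanged. -/
lemma canon_mem_rel {n : ℕ} {alg : Fin n → ι} (c : CSPConstraint A alg)
    {r : ∀ k : Fin c.arity, A (alg (c.scope k))} (hr : r ∈ c.tuples) :
    (fun k => D.canon _ (D.toZ _ (r k))) ∈ c.tuples := by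
  have key : ∀ s : Finset (Fin c.arity), ∃ x ∈ c.tuples,
      (∀ k, D.toZ _ (x k) = D.toZ _ (r k)) ∧ ∀ k ∈ s, x k = D.canon _ (D.toZ _ (r k)) := by
    intro s
    induction s using Finset.induction_on with
    | empty => exact ⟨r, hr, fun _ => rfl, by simp⟩
    | insert j s _ ih =>
      obtain ⟨x, hx, h1, h2⟩ := ih
      obtain ⟨y, hy, hyj⟩ := c.subdirect j (D.base _)
      refine ⟨x * ((x * y) * y), c.mul_mem _ hx _ (c.mul_mem _ (c.mul_mem _ hx _ hy) _ hy),
        fun k => ?_, fun k hk => ?_⟩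
      · simp only [Pi.mul_apply]
        rw [D.toZ_mul_mul, h1]
      · simp only [Pi.mul_apply]
        obtain rfl | hk := Finset.mem_insert.1 hk
        · rw [hyj, D.mul_base, h1]
        · rw [h2 k hk, D.canon_mul]
  obtain ⟨x, hx, -, h⟩ := key Finset.univ
  convert hx using 1
  funext k
  exact (h k (Finset.mem_univ k)).symm

theorem isSolution_canon (I : CSPInstance A) (g : Fin I.n → ZMod 3)
    (h : ∀ c ∈ I.constraints, ∃ r ∈ c.tuples, ∀ k, D.toZ _ (r k) = g (c.scope k)) :
    I.IsSolution fun v => D.canon (I.alg v) (g v) := by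
  intro c hc
  obtain ⟨r, hr, hg⟩ := h c hc
  have := D.canon_mem_rel c hr
  simp only [hg] at this
  exact this

/-- The letters of the input in the working alphabet. -/
def tokOf : CSPSymbol A → Option Tok
  | .alg _ => none
  | .elt i a => some (.val (D.toZ i a))
  | .bit b => some (.bit b)
  | .var => some (.var true)
  | .tup => some .tup
  | .con => some .con

/-- A constraint, as a system over `ZMod 3`. -/
def block {n : ℕ} {alg : Fin n → ι} (c : CSPConstraint A alg) : Block :=
  ((List.ofFn c.scope).map Fin.val, c.tuples.map fun x => List.ofFn fun k => D.toZ _ (x k))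

/-- An instance, as a system over `ZMod 3`. -/
def system (I : CSPInstance A) : List Block := I.constraints.map D.block

lemma seq_ofFn {n : ℕ} (f : Fin n → ZMod 3) (i : ℕ) :
    seq (List.ofFn f) i = if h : i < n then f ⟨i, h⟩ else 0 := by
  by_cases h : i < n <;> simp [seq, h]

lemma block_isAffine {n : ℕ} {alg : Fin n → ι} (c : CSPConstraint A alg) :
    (D.block c).IsAffine where
  length_eq t ht := by
    obtain ⟨x, -, rfl⟩ := List.mem_map.1 ht
    simp [block]
  closed s hs t ht := by
    obtain ⟨x, hx, rfl⟩ := List.mem_map.1 hs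
    obtain ⟨y, hy, rfl⟩ := List.mem_map.1 ht
    refine ⟨_, List.mem_map.2 ⟨_, c.mul_mem x hx y hy, rfl⟩, ?_⟩
    funext i
    simp only [seq_ofFn, Pi.neg_apply, Pi.add_apply, Pi.mul_apply, D.toZ_mul]
    split_ifs <;> simp

/-- A solution maps to a solution over `ZMod 3`; conversely, canonical representatives lift one
back. -/
lemma hasSolution_iff (I : CSPInstance A) :
    I.HasSolution ↔ ∃ g : ℕ → ZMod 3, ∀ b ∈ D.system I, b.1.map g ∈ b.2 := by
  have hmem : ∀ (g : ℕ → ZMod 3) (c : CSPConstraint A I.alg),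
      (D.block c).1.map g ∈ (D.block c).2 ↔
        ∃ r ∈ c.tuples, ∀ k, D.toZ _ (r k) = g (c.scope k) := by
    intro g c
    simp only [block, List.map_ofFn, List.mem_map, List.ofFn_inj, funext_iff, Function.comp_apply]
  simp only [system, List.forall_mem_map, hmem]
  constructor
  · rintro ⟨f, hf⟩
    refine ⟨fun v => if h : v < I.n then D.toZ _ (f ⟨v, h⟩) else 0, fun c hc =>
      ⟨_, hf c hc, fun k => ?_⟩⟩
    simp
  · rintro ⟨g, hg⟩
    exact ⟨_, D.isSolution_canon I (fun v => g v) hg⟩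

lemma filterMap_comp_bit (w : List Bool) :
    w.filterMap (D.tokOf ∘ CSPSymbol.bit) = w.map Tok.bit := by
  induction w with
  | nil => rfl
  | cons b w ih => simp [tokOf, ih]

lemma filterMap_encode_constraint {n : ℕ} {alg : Fin n → ι} (c : CSPConstraint A alg) :
    c.encode.filterMap D.tokOf =
      Tok.con :: (((D.block c).1.flatMap fun v => numWord (num 0 v)) ++
        (D.block c).2.flatMap tupleWord) := by
  have h1 : ∀ l : List (Fin n), (l.flatMap fun v : Fin n =>
      CSPSymbol.var :: (Computability.encodeNat (v : ℕ)).map (CSPSymbol.bit (A := A))).filterMap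
        D.tokOf = (l.map Fin.val).flatMap fun v => numWord (num 0 v) := by
    intro l
    induction l with
    | nil => rfl
    | cons v l ih =>
      simp only [List.flatMap_cons, List.filterMap_append, ih, List.map_cons]
      simp [tokOf, numWord, num, filterMap_comp_bit]
  have h2 : ∀ l : List (∀ k : Fin c.arity, A (alg (c.scope k))), (l.flatMap fun x =>
      CSPSymbol.tup :: List.ofFn fun k => CSPSymbol.elt (alg (c.scope k)) (x k)).filterMap
        D.tokOf = (l.map fun x => List.ofFn fun k => D.toZ _ (x k)).flatMap tupleWord := by
    intro l
    induction l with
    | nil => rfl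
    | cons x l ih =>
      simp only [List.flatMap_cons, List.filterMap_append, ih, List.map_cons]
      have : (List.ofFn fun k => CSPSymbol.elt (alg (c.scope k)) (x k)).filterMap D.tokOf =
          (List.ofFn fun k => D.toZ _ (x k)).map Tok.val := by
        rw [List.map_ofFn, List.ofFn_eq_map, List.ofFn_eq_map, List.filterMap_map]
        simp [tokOf, Function.comp_def]
      simp [tokOf, tupleWord, this]
  rw [CSPConstraint.encode, List.cons_append, List.filterMap_cons]
  simp only [tokOf, List.filterMap_append, h1, h2, block]

lemma filterMap_encode (I : CSPInstance A) :
    I.encode.filterMap D.tokOf = word (num 0) (D.system I) := by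
  have h1 : (List.ofFn fun v => CSPSymbol.alg (A := A) (I.alg v)).filterMap D.tokOf = [] := by
    rw [List.filterMap_eq_nil_iff]
    intro x hx
    obtain ⟨v, rfl⟩ := List.mem_ofFn.1 hx
    rfl
  rw [CSPInstance.encode, List.filterMap_append, h1, List.nil_append, system]
  induction I.constraints with
  | nil => rfl
  | cons c l ih =>
    rw [List.flatMap_cons, List.filterMap_append, ih, filterMap_encode_constraint]
    simp [word]

end Reduction

/-! ### The whole run and its polynomial time bound -/

lemma width_add_tupleCount_le (f : ℕ → Bool × List Bool) (S : List Block) :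
    width S + tupleCount S ≤ (word f S).length := by
  have h1 : ∀ vs : List ℕ, vs.length ≤ (vs.flatMap fun v => numWord (f v)).length := by
    intro vs
    induction vs with
    | nil => simp
    | cons v vs ih => simp [numWord] at ih ⊢; omega
  have h2 : ∀ ts : List (List (ZMod 3)), ts.length ≤ (ts.flatMap tupleWord).length := by
    intro ts
    induction ts with
    | nil => simp
    | cons v ts ih => simp [tupleWord] at ih ⊢; omega
  induction S with
  | nil => simp [word, width, tupleCount]
  | cons b S ih =>
    have := h1 b.1
    have := h2 b.2
    simp only [word, width, tupleCount, List.length_cons, List.length_append]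
    omega

/-- The machine decides in polynomial time whether a system has a solution. -/
lemma within_run {X : Type} {tokOf : X → Option Tok} (x : List X) {S : List Block}
    (hx : x.filterMap tokOf = word (num 0) S) (hS : ∀ b ∈ S, b.IsAffine)
    (hv : ∀ b ∈ S, ∀ v ∈ b.1, v < x.length) :
    ∃ b : Bool, (b = true ↔ ∃ g : ℕ → ZMod 3, ∀ b ∈ S, b.1.map g ∈ b.2) ∧
      Within tokOf (100 * (x.length + 1) ^ 3)
        (conf (some .read) {} x [] [] [] [] [] [] [] [])
        (conf none {} [] [b] [] [] [] [] [] [] []) := by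
  have hL := List.length_filterMap_le tokOf x
  have h1 := within_read (tokOf := tokOf) x [] [] [] [] [] [] [] []
  rw [hx] at hL h1
  have h2 := within_back (tokOf := tokOf) [] [] [] []
    ((List.replicate x.length [Mode.scope, Mode.search]).flatten ++ []) [(true, 1)] [] [] []
    .const (word (num 0) S)
  rw [bwd_const_word] at h2
  have hW := width_add_tupleCount_le (num 0) S
  obtain ⟨T', cols, S', hP, hT', hcols, h3⟩ := within_passes (tokOf := tokOf) [] [] [] [] []
    x.length (zero_add _) (Partway.init (S := S) (B := x.length) (by omega)) hL
  have hlen : ∀ c ∈ cols, c.length = width S + 1 := by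
    intro c hc
    obtain rfl | ⟨h, rfl⟩ | ⟨d, hd, rfl⟩ := hP.sound c hc
    · simp
    · simp
    · simp [hd.length_eq hS]
  obtain ⟨b, w, hb, hw, h4⟩ := within_solve (tokOf := tokOf) [] [] [] T' [] hlen
    -- One column of constants, and two columns per input letter.
    (N := 2 * x.length + 1) (by rw [hcols]; simp; omega)
  have h5 := within_clean (tokOf := tokOf) [] [] [] T' [] w [] [] [] b (2 * x.length + 1)
    (by omega) hw
  refine ⟨b, by rw [hb, hP.isColumns.separated_iff hv hS], ?_⟩
  simp only [List.append_nil] at h1 h2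
  refine (h1.trans (h2.trans ((Within.of_step ?_).trans (h3.trans ((Within.of_step ?_).trans
    (h4.trans h5)))))).mono ?_
  · simp [conf, program, contents, entries_append]
  · simp [conf, program, contents]
  · have h6 : (width S + 1) * ((2 * x.length + 1 + 1) * (3 * width S + 8)) ≤
        (x.length + 1) * ((2 * x.length + 1 + 1) * (3 * x.length + 8)) := by
      gcongr <;> omega
    have h7 : (x.length + 1) * ((2 * x.length + 1 + 1) * (3 * x.length + 8)) +
        x.length * (4 * x.length + 6) + 4 * x.length + 6 ≤ 100 * (x.length + 1) ^ 3 := by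
      ring_nf
      omega
    omega

instance {ι : Type} [Finite ι] (A : ι → Type) [∀ i, Finite (A i)] : Finite (CSPSymbol A) := by
  refine Finite.of_injective (β := ι ⊕ (Σ i, A i) ⊕ Bool ⊕ Fin 3) (fun
    | .alg i => .inl i
    | .elt i a => .inr (.inl ⟨i, a⟩)
    | .bit b => .inr (.inr (.inl b))
    | .var => .inr (.inr (.inr 0))
    | .tup => .inr (.inr (.inr 1))
    | .con => .inr (.inr (.inr 2))) ?_
  intro x y h
  cases x <;> cases y <;> simp_all

/-- The machine, as a bundled machine. -/
noncomputable def machine {X : Type} [Finite X] (tokOf : X → Option Tok) : FinTM2 where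
  K := Stk
  k₀ := .inp
  k₁ := .out
  Γ := Alphabet X
  Λ := Label
  main := .read
  σ := St
  initialState := {}
  Γk₀Fin := Fintype.ofFinite X
  m := program tokOf

theorem Reduction.tractable {ι : Type} [Finite ι] {A : ι → Type} [∀ i, Mul (A i)]
    [∀ i, Finite (A i)] (D : Reduction A) : CSPTractable A := by
  classical
  have key : ∀ I : CSPInstance A, Within D.tokOf (100 * (I.encode.length + 1) ^ 3)
      (conf (some .read) {} I.encode [] [] [] [] [] [] [] [])
      (conf none {} [] [decide I.HasSolution] [] [] [] [] [] [] []) := by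
    intro I
    obtain ⟨b, hb, h⟩ := within_run I.encode (D.filterMap_encode I)
      (by simpa [Reduction.system] using fun c _ => D.block_isAffine c) (by
        simp only [Reduction.system, List.forall_mem_map, Reduction.block]
        intro c _ v _
        -- The encoding begins with one letter per variable, so its length bounds every index.
        refine v.2.trans_le ?_
        simp [CSPInstance.encode])
    rw [← D.hasSolution_iff] at hb
    obtain rfl : b = decide I.HasSolution := by
      rw [Bool.eq_iff_iff, hb, decide_eq_true_iff]
    exact h
  choose k hk h using key
  refine ⟨{
    tm := machine D.tokOf
    inputAlphabet := Equiv.refl _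
    outputAlphabet := Equiv.refl _
    time := Polynomial.C 100 * (Polynomial.X + 1) ^ 3
    outputsFun := fun I => ⟨⟨k I, ?_⟩, ?_⟩ }⟩
  · have h1 : initList (machine D.tokOf) I.encode =
        conf (some .read) {} I.encode [] [] [] [] [] [] [] [] := by
      simp only [initList, conf]
      congr 1
      funext j
      cases j <;> rfl
    have h2 : haltList (machine D.tokOf) [decide I.HasSolution] =
        conf none {} [] [decide I.HasSolution] [] [] [] [] [] [] [] := by
      simp only [haltList, conf]
      congr 1
      funext j
      cases j <;> rfl
    have h3 := h I
    rw [← h1, ← h2] at h3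
    convert! h3 using 2
    exact congrArg (fun l => some (initList (machine D.tokOf) l)) (List.map_id _)
  · simpa using hk I

end AffineCSP

open AffineCSP

/-! ### The two-element semilattice and the Steiner quasigroup -/

namespace SltSq3

instance : Finite SltSq3 :=
  Finite.of_injective (fun i => decide (i = slt)) fun i j h => by cases i <;> cases j <;> simp_all

instance : ∀ i : SltSq3, Fintype (Carrier i)
  | slt => inferInstanceAs (Fintype (Fin 2))
  | sq3 => inferInstanceAs (Fintype (Fin 3))

instance : ∀ i : SltSq3, DecidableEq (Carrier i)
  | slt => inferInstanceAs (DecidableEq (Fin 2))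
  | sq3 => inferInstanceAs (DecidableEq (Fin 3))

/-- The trivial map on `Slt`, and the bijection from `Sq3` to `ZMod 3`. -/
def toZ : ∀ i, Carrier i → ZMod 3
  | slt => fun _ => 0
  | sq3 => fun x => (x : Fin 3)

/-- The element `0` of `Slt`, and the inverse of the bijection from `Sq3` to `ZMod 3`. -/
def canon : ∀ i, ZMod 3 → Carrier i
  | slt => fun _ => (0 : Fin 2)
  | sq3 => fun z => (z : Fin 3)

/-- The trivial map on `Slt`, and the bijection from `Sq3` to `ZMod 3`, as a reduction. -/
def reduction : Reduction Carrier where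
  toZ := toZ
  canon := canon
  base := zero
  toZ_mul i := by cases i <;> decide
  mul_base i := by cases i <;> decide
  canon_mul i := by cases i <;> decide

/-- Only the coordinates in `Sq3` carry information in `ZMod 3`. Extended by 0, a partial solution
thus solves the image, and its canonical lift is `f` on `Sq3` and the bottom on `Slt`. -/
theorem isSolution_of_isPartialSolution (I : CSPInstance Carrier)
    (f : ∀ v : {v | I.alg v = sq3}, Carrier (I.alg v))
    (hf : I.IsPartialSolution {v | I.alg v = sq3} f) :
    I.IsSolution fun v => if h : I.alg v = sq3 then f ⟨v, h⟩ else zero (I.alg v) := by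
  have h1 : ∀ (i : SltSq3) (x : Carrier i), i = sq3 → reduction.canon i (reduction.toZ i x) = x := by
    rintro _ x rfl
    rfl
  have h2 : ∀ (i : SltSq3) (z : ZMod 3), i ≠ sq3 → reduction.canon i z = zero i := by
    rintro (_ | _) z hi
    · rfl
    · exact absurd rfl hi
  have h3 : ∀ (i : SltSq3) (x : Carrier i), i ≠ sq3 → reduction.toZ i x = 0 := by
    rintro (_ | _) z hi
    · rfl
    · exact absurd rfl hi
  have := reduction.isSolution_canon I
    (fun v => if h : I.alg v = sq3 then reduction.toZ _ (f ⟨v, h⟩) else 0) fun c hc => by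
      obtain ⟨r, hr, h⟩ := hf c hc
      refine ⟨r, hr, fun k => ?_⟩
      split_ifs with hk
      · rw [h k hk]
      · exact h3 _ _ hk
  convert this using 2 with v
  split_ifs with hv
  · exact (h1 _ _ hv).symm
  · exact (h2 _ _ hv).symm

end SltSq3

/-! ### The subalgebras of the four-element binar -/

namespace Cib4

/-- The quotient map onto the Steiner quasigroup. -/
def toZ (x : Cib4) : ZMod 3 := (![0, 0, 1, 2] : Fin 4 → ZMod 3) x

/-- The least element of a fibre of the quotient map, in a subalgebra with or without `0`. -/
def least (b : Bool) (z : ZMod 3) : Cib4 :=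
  ((if b then ![0, 2, 3] else ![1, 2, 3]) : Fin 3 → Fin 4) z

/-- The bottom element. -/
def bot : Cib4 := (0 : Fin 4)

instance : Fintype Cib4 := inferInstanceAs (Fintype (Fin 4))

instance : DecidableEq Cib4 := inferInstanceAs (DecidableEq (Fin 4))

lemma toZ_mul : ∀ x y : Cib4, toZ (x * y) = -(toZ x + toZ y) := by decide

lemma mul_bot : ∀ x : Cib4, x * ((x * bot) * bot) = least true (toZ x) := by decide

/-- The only fibre with two elements is `{0, 1}`. Away from `0` the fibres are thus singletons, and
the term returns `x` itself. -/
lemma mul_of_ne_bot : ∀ x y : Cib4, x ≠ bot → y ≠ bot →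
    x * ((x * y) * y) = least false (toZ x) := by decide

lemma least_true_mul : ∀ x y : Cib4,
    least true (toZ x) * ((least true (toZ x) * y) * y) = least true (toZ x) := by decide

lemma least_true_eq : ∀ x : Cib4, least true (toZ x) = bot ∨ least true (toZ x) = x := by decide

lemma least_false_eq : ∀ x : Cib4, x ≠ bot → least false (toZ x) = x := by decide

instance (B : {B : Subsemigroup Cib4 // (B : Set Cib4).Nonempty}) : Finite (Subalgebras Cib4 B) :=
  inferInstanceAs (Finite ↥B.1)

instance : Finite {B : Subsemigroup Cib4 // (B : Set Cib4).Nonempty} :=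
  Finite.of_injective (fun B => (B.1 : Set Cib4)) fun _ _ h => Subtype.ext (SetLike.coe_injective h)

open Classical in
lemma least_mem {B : Subsemigroup Cib4} {x : Cib4} (hx : x ∈ B) :
    least (decide (bot ∈ B)) (toZ x) ∈ B := by
  by_cases h : bot ∈ B
  · obtain h' | h' := least_true_eq x
    · simp [h, h']
    · simpa [h, h'] using hx
  · have := least_false_eq x fun h' => h (h' ▸ hx)
    simp [h, this, hx]

/-- The inclusion of a subalgebra. -/
def incl {B : {B : Subsemigroup Cib4 // (B : Set Cib4).Nonempty}} (x : Subalgebras Cib4 B) : Cib4 :=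
  Subtype.val x

/-- An element of a subalgebra. -/
def ofMem {B : {B : Subsemigroup Cib4 // (B : Set Cib4).Nonempty}} {x : Cib4} (h : x ∈ B.1) :
    Subalgebras Cib4 B := Subtype.mk x h

open Classical in
/-- The least element of a fibre, as an element of a subalgebra. -/
noncomputable def canon (B : {B : Subsemigroup Cib4 // (B : Set Cib4).Nonempty}) (z : ZMod 3) :
    Subalgebras Cib4 B :=
  if h : least (decide (bot ∈ B.1)) z ∈ B.1 then ofMem h
  -- An arbitrary value for fibres that the subalgebra does not meet; it plays no role on images of
  -- its elements.
  else ofMem B.2.choose_spec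

open Classical in
/-- The bottom element of a subalgebra, or any element, if there is none. -/
noncomputable def base (B : {B : Subsemigroup Cib4 // (B : Set Cib4).Nonempty}) :
    Subalgebras Cib4 B :=
  if h : bot ∈ B.1 then ofMem h else ofMem B.2.choose_spec

section Subalgebra

variable {B : {B : Subsemigroup Cib4 // (B : Set Cib4).Nonempty}} (x y : Subalgebras Cib4 B)

lemma incl_injective : Function.Injective (incl (B := B)) := Subtype.val_injective

lemma incl_mem : incl x ∈ B.1 := Subtype.property x

lemma incl_mul : incl (x * y) = incl x * incl y := rfl

open Classical in
lemma incl_canon : incl (canon B (toZ (incl x))) = least (decide (bot ∈ B.1)) (toZ (incl x)) := by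
  unfold canon
  rw [dif_pos (least_mem (incl_mem x))]
  rfl

lemma incl_base (h : bot ∈ B.1) : incl (base B) = bot := by
  unfold base
  rw [dif_pos h]
  rfl

lemma incl_ne_bot (h : bot ∉ B.1) : incl x ≠ bot := fun h' => h (h' ▸ incl_mem x)

end Subalgebra

/-- The quotient maps of the subalgebras of `Cib4`, as a reduction. -/
noncomputable def reduction : Reduction (Subalgebras Cib4) where
  toZ _ x := toZ (incl x)
  canon := canon
  base := base
  toZ_mul _ x y := toZ_mul (incl x) (incl y)
  mul_base B x := by
    apply incl_injective
    by_cases h : bot ∈ B.1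
    · simp only [incl_mul, incl_canon, incl_base h, h, decide_true, mul_bot]
    · simp only [incl_mul, incl_canon, h, decide_false]
      exact mul_of_ne_bot _ _ (incl_ne_bot _ h) (incl_ne_bot _ h)
  canon_mul B x y := by
    apply incl_injective
    by_cases h : bot ∈ B.1
    · simp only [incl_mul, incl_canon, h, decide_true, least_true_mul]
    · simp only [incl_mul, incl_canon, h, decide_false]
      have hx := incl_ne_bot x h
      rw [least_false_eq _ hx, mul_of_ne_bot _ _ hx (incl_ne_bot y h), least_false_eq _ hx]

end Cib4

theorem mainTheorem11 :
    CSPTractable SltSq3.Carrier ∧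
    (∀ I : CSPInstance SltSq3.Carrier,
      (I.HasSolution ↔
        ∃ f : ∀ v : {v | I.alg v = SltSq3.sq3}, SltSq3.Carrier (I.alg v),
          I.IsPartialSolution {v | I.alg v = SltSq3.sq3} f) ∧
      (∀ f : ∀ v : {v | I.alg v = SltSq3.sq3}, SltSq3.Carrier (I.alg v),
        I.IsPartialSolution {v | I.alg v = SltSq3.sq3} f →
        I.IsSolution fun v =>
          if h : I.alg v = SltSq3.sq3 then f ⟨v, h⟩ else SltSq3.zero (I.alg v))) ∧
    CSPTractable (Subalgebras Cib4) := by
  refine ⟨SltSq3.reduction.tractable, fun I => ⟨⟨?_, ?_⟩,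
    SltSq3.isSolution_of_isPartialSolution I⟩, Cib4.reduction.tractable⟩
  · rintro ⟨f, hf⟩
    exact ⟨fun v => f v, fun c hc => ⟨_, hf c hc, fun k _ => rfl⟩⟩
  · rintro ⟨f, hf⟩
    exact ⟨_, SltSq3.isSolution_of_isPartialSolution I f hf⟩
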